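/- Let $T>0$ and let $W=(W_t)_{0\le t\le T}$ be a standard one-dimensional Brownian motion with $W_0=0$ on a probability space. For $N\ge 1$ and $0\le l\le N$ put $t_l=lT/N$; for $1\le l\le N$ put $\Delta W^N_l=W_{t_l}-W_{t_{l-1}}$, and let $\mathcal G^N_l=\sigma(\Delta W^N_1,\dots,\Delta W^N_l)$, with $\mathcal G^N_0$ trivial. For each $N\ge 1$ let $X^N=F_N(\Delta W^N_1,\dots,\Delta W^N_N)\in L^2(\mathcal G^N_N)$ belong to $\mathbb D^{(N)}_{2,2}$; that is, for every $l=1,\dots,N$ the distributional derivatives $\partial_l F_N$ and $\partial_l^2F_N$ on $\mathbb R^N$ are functions, and $\partial_l^mX^N:=(\partial_l^mF_N)(\Delta W^N_1,\dots,\Delta W^N_N)\in L^2$ for $m=1,2$. Put $D_t^2X^N=\partial_l^2X^N$ for $t_{l-1}\le t<t_l$. If $$\sup_{N\ge 1}\int_0^T\|D_t^2X^N\|_{L^2}^2\,dt<\infty,$$ then the error of the first-order discrete Clark–Ocone approximation lies in $L^2$ for every $N\ge1$, and $$\Big\|X^N-\Big\{\mathbf E[X^N]+\sum_{l=1}^N\mathbf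 E[\partial_lX^N\mid\mathcal G^N_{l-1}]\,\Delta W^N_l\Big\}\Big\|_{L^2}=O(N^{-1/2})\qquad(N\to\infty).$$ -/

import Mathlib

open MeasureTheory ProbabilityTheory Filter
open scoped ENNReal

namespace DiscreteClarkOcone

/-- `W` is a standard one-dimensional Brownian motion on `[0, T]` under `P`, started at `0`
(only the values `W t` with `t ∈ [0, T]` are relevant). -/
structure IsBrownianMotionOn {Ω : Type*} [MeasurableSpace Ω] (T : ℝ) (W : ℝ → Ω → ℝ)
    (P : Measure Ω) : Prop where
  measurable : ∀ t ∈ Set.Icc 0 T, Measurable (W t)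
  start_zero : ∀ᵐ ω ∂P, W 0 ω = 0
  indep_increments : HasIndepIncrements (fun t : Set.Icc (0 : ℝ) T => W t) P
  law_increments : ∀ s t : ℝ, 0 ≤ s → s ≤ t → t ≤ T →
    HasLaw (fun ω => W t ω - W s ω) (gaussianReal 0 (t - s).toNNReal) P
  continuous_paths : ∀ᵐ ω ∂P, ContinuousOn (fun t => W t ω) (Set.Icc 0 T)

/-- The grid point `t_k = k T / N`. -/
noncomputable def gridPoint (T : ℝ) (N k : ℕ) : ℝ := (k : ℝ) * T / N

/-- The increment of `W` over the grid cell `[t_l, t_{l+1}]`, with cells indexed by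
`l = 0, …, N - 1`; in one-based numbering this is `ΔW_{l+1}`. -/
noncomputable def incr {Ω : Type*} (T : ℝ) (W : ℝ → Ω → ℝ) (N : ℕ) (l : Fin N) (ω : Ω) : ℝ :=
  W (gridPoint T N (l + 1)) ω - W (gridPoint T N l) ω

/-- The σ-algebra `𝒢_k` generated by the first `k` increments. -/
noncomputable abbrev sigmaIncr {Ω : Type*} (T : ℝ) (W : ℝ → Ω → ℝ) (N k : ℕ) : MeasurableSpace Ω :=
  ⨆ (j : Fin N) (_ : (j : ℕ) < k), MeasurableSpace.comap (incr T W N j) inferInstance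

/-- The classical partial derivative `∂_l φ` of a function on `ℝ^N`. -/
noncomputable def partialDeriv {N : ℕ} (l : Fin N) (φ : (Fin N → ℝ) → ℝ) : (Fin N → ℝ) → ℝ :=
  fun x => fderiv ℝ φ x (Pi.single l 1)

/-- `G` is the distributional derivative `∂_l^m F` on `ℝ^N`, where `F` and `G` are locally
integrable. The test functions are smooth and compactly supported, since functions that are square
integrable for a Gaussian measure may grow too fast to be tempered. -/
def IsWeakPartialDeriv {N : ℕ} (l : Fin N) (m : ℕ) (F G : (Fin N → ℝ) → ℝ) : Prop :=
  LocallyIntegrable F ∧ LocallyIntegrable G ∧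
    ∀ φ : (Fin N → ℝ) → ℝ, ContDiff ℝ ((⊤ : ℕ∞) : WithTop ℕ∞) φ → HasCompactSupport φ →
      ∫ x, F x * ((partialDeriv l)^[m] φ) x = (-1) ^ m * ∫ x, G x * φ x

/-- `Y = ∂_l^m X` for functionals `X = F(ΔW_1, …, ΔW_N)` and `Y = G(ΔW_1, …, ΔW_N)` of the
increments, that is, `G = ∂_l^m F` in the distribution sense on `ℝ^N`. -/
def IsFunctionalDeriv {Ω : Type*} [MeasurableSpace Ω] (T : ℝ) (W : ℝ → Ω → ℝ) (P : Measure Ω)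
    {N : ℕ} (l : Fin N) (m : ℕ) (X Y : Ω → ℝ) : Prop :=
  ∃ F G : (Fin N → ℝ) → ℝ, Measurable F ∧ Measurable G ∧
    X =ᵐ[P] (fun ω => F (fun j => incr T W N j ω)) ∧
    Y =ᵐ[P] (fun ω => G (fun j => incr T W N j ω)) ∧
    IsWeakPartialDeriv l m F G

/-- The space `𝔻_{2,n}^{(N)}`: the functionals `X ∈ L²(𝒢_N)` whose distributional derivatives
`∂_l^m X`, for `1 ≤ m ≤ n` and all coordinates `l`, are in `L²`. For fixed `N` the mixed derivatives
of order up to `n` are then in `L²` as well. -/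
def MemD {Ω : Type*} [MeasurableSpace Ω] (T : ℝ) (W : ℝ → Ω → ℝ) (P : Measure Ω)
    (N n : ℕ) (X : Ω → ℝ) : Prop :=
  MemLp X 2 P ∧ AEStronglyMeasurable[sigmaIncr T W N N] X P ∧
    ∀ (l : Fin N) (m : ℕ), 1 ≤ m → m ≤ n →
      ∃ Y : Ω → ℝ, MemLp Y 2 P ∧ IsFunctionalDeriv T W P l m X Y

open Classical in
/-- The derivative `∂_l^m X ∈ L²` of a functional of the increments; it is unique up to almost sure
equality. (Set to `0` if there is no such derivative in `L²`.) -/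
noncomputable def functionalDeriv {Ω : Type*} [MeasurableSpace Ω] (T : ℝ) (W : ℝ → Ω → ℝ)
    (P : Measure Ω) {N : ℕ} (l : Fin N) (m : ℕ) (X : Ω → ℝ) : Ω → ℝ :=
  if h : ∃ Y : Ω → ℝ, MemLp Y 2 P ∧ IsFunctionalDeriv T W P l m X Y then h.choose else 0

/-- The process `D_t^m X`, equal to the derivative of order `m` in the increment over the cell
`[t_l, t_{l+1})` for `t` in that cell. -/
noncomputable def malliavinDeriv {Ω : Type*} [MeasurableSpace Ω] (T : ℝ) (W : ℝ → Ω → ℝ)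
    (P : Measure Ω) (N m : ℕ) (X : Ω → ℝ) (t : ℝ) (ω : Ω) : ℝ :=
  ∑ l : Fin N, (Set.Ico (gridPoint T N l) (gridPoint T N (l + 1))).indicator
    (fun _ => functionalDeriv T W P l m X ω) t

/-- The first-order discrete Clark–Ocone approximation `E[X] + ∑_l E[∂_l X | 𝒢_{l-1}] ΔW_l`
(the conditioning is on the increments strictly before the one in question). -/
noncomputable def clarkOconeApprox {Ω : Type*} [MeasurableSpace Ω] (T : ℝ) (W : ℝ → Ω → ℝ)
    (P : Measure Ω) (N : ℕ) (X : Ω → ℝ) (ω : Ω) : ℝ :=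
  (∫ ω', X ω' ∂P) +
    ∑ l : Fin N, (P[functionalDeriv T W P l 1 X | sigmaIncr T W N l]) ω * incr T W N l ω

end DiscreteClarkOcone

/-! The increments turn $P$ into a product of $N$ centred Gaussians of variance $v=T/N$, where
conditioning on a set of increments means averaging over the other coordinates
(`condExp_comp_eq_partialAvg`). The error telescopes into `remainder` terms $R_l = E[F\mid\mathcal
G_l]-E[F\mid\mathcal G_{l-1}]-E[\partial_lF\mid\mathcal G_{l-1}]x_l$, which are martingale
differences, hence orthogonal; so only each $\|R_l\|^2$ has to be bounded.

Let $A_l$ be the average over $x_l$ alone and $C=A_l\partial_lF$. Then $R_l$ is the conditional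
expectation given $\mathcal G_l$ of $F'-A_lF'$ with $F'=F-C\,x_l$, and
$\partial_lF'=\partial_lF-A_l\partial_lF$ is again centred in $x_l$. Two uses of the one-coordinate
Poincaré inequality (`lintegral_sq_sub_partialAvg_le`), on $F'$ and then on $\partial_lF$, give
$\|R_l\|^2\le(2v)^2\|\partial_l^2F\|^2$. Summing, one factor $v$ is the mesh of the integral
$\int_0^T\|D_t^2X\|^2dt$ and the other is the rate: the squared error is at most
$4(T/N)\int_0^T\|D_t^2X\|^2dt$.

Poincaré is proved from the fundamental theorem of calculus on lines, which the distributional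
derivatives satisfy for almost every line and almost every pair of endpoints
(`ae_shift_sub_eq_integral`, `isLineDeriv_of_isWeakPartialDeriv`). No absolutely continuous
representative is chosen. -/

namespace DiscreteClarkOcone

open scoped NNReal Topology

/-! ### Weak directional derivatives and integration along segments. -/

section Shift

set_option linter.unusedSectionVars false

variable {E : Type*} [NormedAddCommGroup E] [NormedSpace ℝ E] [FiniteDimensional ℝ E]
  [MeasurableSpace E] [BorelSpace E] {μ : Measure E} [μ.IsAddHaarMeasure]

lemma isCompact_translates {K : Set E} (hK : IsCompact K) (e : E) (a b : ℝ) :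
    IsCompact ((fun p : ℝ × E => p.2 + p.1 • e) '' (Set.Icc a b ×ˢ K)) :=
  (isCompact_Icc.prod hK).image (by fun_prop)

lemma integrableOn_translate {G : E → ℝ} (hG : LocallyIntegrable G μ) {K : Set E}
    (hK : IsCompact K) (y : E) : IntegrableOn (fun x => G (x + y)) K μ := by
  have h1 : IsCompact ((fun x => x + y) '' K) := hK.image (by fun_prop)
  have h2 := hG.integrableOn_isCompact h1
  have h3 := ((measurePreserving_add_right μ y).integrableOn_image
    (MeasurableEquiv.addRight y).measurableEmbedding (f := G) (s := K)).1 h2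
  exact h3

lemma locallyIntegrable_translate {G : E → ℝ} (hG : LocallyIntegrable G μ) (y : E) :
    LocallyIntegrable (fun x => G (x + y)) μ :=
  locallyIntegrable_iff.2 fun _ hK => integrableOn_translate hG hK y

/-- Translates of a locally integrable function are jointly integrable over a bounded range of
shifts and a compact set. -/
lemma integrable_prod_translate {G : E → ℝ} (hGm : Measurable G) (hG : LocallyIntegrable G μ)
    {K : Set E} (hK : IsCompact K) (e : E) (a b : ℝ) :
    Integrable (fun p : ℝ × E => G (p.2 + p.1 • e))
      ((volume.restrict (Set.Icc a b)).prod (μ.restrict K)) := by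
  have hm : Measurable (fun p : ℝ × E => G (p.2 + p.1 • e)) := hGm.comp (by fun_prop)
  rw [integrable_prod_iff hm.aestronglyMeasurable]
  refine ⟨ae_of_all _ fun s => integrableOn_translate hG hK (s • e), ?_⟩
  set K' := (fun p : ℝ × E => p.2 + p.1 • e) '' (Set.Icc a b ×ˢ K) with hK'
  have hKi : IntegrableOn G K' μ := hG.integrableOn_isCompact (isCompact_translates hK e a b)
  -- Every translate of `K` by `s • e` with `s` in the range lies in the compact `K'`, so the $L^1$
  -- norm of `G` over `K'` bounds all slices at once.
  refine Measure.integrableOn_of_bounded (M := ∫ x in K', ‖G x‖ ∂μ) (by simp) ?_ ?_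
  · exact (hm.norm.stronglyMeasurable.integral_prod_right').aestronglyMeasurable
  · refine (ae_restrict_iff' measurableSet_Icc).2 (ae_of_all _ fun s hs => ?_)
    rw [Real.norm_of_nonneg (integral_nonneg fun _ => norm_nonneg _)]
    have := (measurePreserving_add_right μ (s • e)).setIntegral_image_emb
      (MeasurableEquiv.addRight (s • e)).measurableEmbedding (fun x => ‖G x‖) K
    simp only at this ⊢
    rw [← this]
    refine setIntegral_mono_set hKi.norm (ae_of_all _ fun _ => norm_nonneg _) ?_
    refine Eventually.of_forall ?_
    rintro _ ⟨x, hx, rfl⟩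
    exact ⟨(s, x), ⟨hs, hx⟩, rfl⟩

/-- A function with a weak derivative `G` in direction `e` is the integral of `G` along almost
every segment in direction `e`. -/
theorem ae_shift_sub_eq_integral {F G : E → ℝ} (e : E) (hGm : Measurable G)
    (hF : LocallyIntegrable F μ) (hG : LocallyIntegrable G μ)
    (h : ∀ φ : E → ℝ, ContDiff ℝ ((⊤ : ℕ∞) : WithTop ℕ∞) φ → HasCompactSupport φ →
      ∫ x, F x * fderiv ℝ φ x e ∂μ = - ∫ x, G x * φ x ∂μ) (τ : ℝ) (hτ : 0 ≤ τ) :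
    ∀ᵐ x ∂μ, F (x + τ • e) - F x = ∫ s in (0 : ℝ)..τ, G (x + s • e) := by
  have hint : ∀ {K : Set E}, IsCompact K → Integrable (fun p : ℝ × E => G (p.2 + p.1 • e))
      ((volume.restrict (Set.Ioc 0 τ)).prod (μ.restrict K)) := fun {K} hK =>
    (integrable_prod_translate hGm hG hK e 0 τ).mono_measure
      (Measure.prod_mono (Measure.restrict_mono Set.Ioc_subset_Icc_self le_rfl) le_rfl)
  have hH : LocallyIntegrable (fun x => ∫ s in (0 : ℝ)..τ, G (x + s • e)) μ := by
    refine locallyIntegrable_iff.2 fun K hK => ?_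
    simp only [intervalIntegral.integral_of_le hτ]
    exact (hint hK).integral_prod_right
  refine ae_eq_of_integral_contDiff_smul_eq
    ((locallyIntegrable_translate hF _).sub hF) hH fun φ hφ hφc => ?_
  have hφd : Differentiable ℝ φ := hφ.differentiable (by simp)
  have hφ1 : Continuous φ := hφ.continuous
  have hdc : Continuous (fun x => fderiv ℝ φ x e) :=
    (hφ.continuous_fderiv (by simp)).clm_apply continuous_const
  have hds : HasCompactSupport (fun x => fderiv ℝ φ x e) := by
    refine (hφc.fderiv (𝕜 := ℝ)).comp_left (g := fun L : E →L[ℝ] ℝ => L e) (by simp)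
  -- the derivative of `τ ↦ ∫ F(x) φ(x - τ e)`
  have hder : ∀ t : ℝ, HasDerivAt (fun t : ℝ => ∫ x, F x * φ (x - t • e) ∂μ)
      (∫ x, G x * φ (x - t • e) ∂μ) t := by
    intro t
    -- For shifts within distance 1 of `t` the translated test functions are all supported in this
    -- one compact set, which gives the integrable dominating function.
    set K := (fun p : ℝ × E => p.2 + p.1 • e) ''
      (Set.Icc (t - 1) (t + 1) ×ˢ tsupport φ) with hK
    have hKc : IsCompact K := isCompact_translates hφc e _ _
    obtain ⟨C, hC⟩ := hds.exists_bound_of_continuous hdc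
    have key := hasDerivAt_integral_of_dominated_loc_of_deriv_le (μ := μ) (𝕜 := ℝ)
      (F := fun (t : ℝ) x => F x * φ (x - t • e))
      (F' := fun (t : ℝ) x => F x * (- fderiv ℝ φ (x - t • e) e)) (x₀ := t)
      (s := Set.Icc (t - 1) (t + 1)) (bound := K.indicator fun x => ‖F x‖ * C)
      (Icc_mem_nhds (by linarith) (by linarith)) ?_ ?_ ?_ ?_ ?_ ?_
    · have h1 := h (fun x => φ (x - t • e)) (by fun_prop)
        (hφc.comp_homeomorph (Homeomorph.subRight (t • e)))
      have h2 : ∀ x, fderiv ℝ (fun x => φ (x - t • e)) x = fderiv ℝ φ (x - t • e) := fun x =>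
        fderiv_comp_sub (f := φ) (t • e)
      simp only [h2] at h1
      have h3 := key.2
      simp only [mul_neg, integral_neg, h1, neg_neg] at h3
      exact h3
    · refine Eventually.of_forall fun s => ?_
      exact hF.aestronglyMeasurable.mul (by fun_prop : Continuous fun x => φ (x - s • e)).aestronglyMeasurable
    · have := hF.integrable_smul_right_of_hasCompactSupport
        (g := fun x => φ (x - t • e)) (by fun_prop)
        (hφc.comp_homeomorph (Homeomorph.subRight (t • e)))
      simpa [smul_eq_mul, mul_comm] using this
    · exact hF.aestronglyMeasurable.mul
        (hdc.comp (by fun_prop : Continuous fun x => x - t • e)).neg.aestronglyMeasurable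
    · refine ae_of_all _ fun x s hs => ?_
      by_cases hx : x ∈ K
      · rw [Set.indicator_of_mem hx, norm_mul, norm_neg]
        exact mul_le_mul_of_nonneg_left (hC _) (norm_nonneg _)
      · rw [Set.indicator_of_notMem hx]
        have : x - s • e ∉ tsupport φ := fun hxs => hx ⟨(s, x - s • e), ⟨hs, hxs⟩, by simp⟩
        have h0 : fderiv ℝ φ (x - s • e) = 0 := by
          by_contra h0
          exact this (support_fderiv_subset ℝ h0)
        simp [h0]
    · exact (integrable_indicator_iff hKc.measurableSet).2
        ((hF.integrableOn_isCompact hKc).norm.mul_const C)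
    · refine ae_of_all _ fun x s _ => ?_
      have h1 : HasDerivAt (fun s : ℝ => x - s • e) (-e) s := by
        simpa using ((hasDerivAt_id s).smul_const e).const_sub x
      have h2 := (hφd (x - s • e)).hasFDerivAt.comp_hasDerivAt s h1
      simpa using h2.const_mul (F x)
  have htr : ∀ (A : E → ℝ) (t : ℝ),
      ∫ x, A x * φ (x - t • e) ∂μ = ∫ x, A (x + t • e) * φ x ∂μ := fun A t => by
    rw [← integral_add_right_eq_self (fun x => A x * φ (x - t • e)) (t • e)]
    simp
  -- Joint integrability is only available over compact sets, so the swap of integrals below is done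
  -- on the support of `φ`.
  have hrest : ∀ A : E → ℝ, ∫ x in tsupport φ, A x * φ x ∂μ = ∫ x, A x * φ x ∂μ := fun A =>
    setIntegral_eq_integral_of_forall_compl_eq_zero fun x hx => by
      simp [image_eq_zero_of_notMem_tsupport hx]
  obtain ⟨C, hC⟩ := hφc.exists_bound_of_continuous hφ1
  have hint2 : Integrable (fun p : ℝ × E => G (p.2 + p.1 • e) * φ p.2)
      ((volume.restrict (Set.Ioc 0 τ)).prod (μ.restrict (tsupport φ))) :=
    (hint hφc).mul_bdd (c := C) (by fun_prop : Continuous fun p : ℝ × E => φ p.2).aestronglyMeasurable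
      (ae_of_all _ fun p => hC _)
  have hv : IntervalIntegrable (fun t => ∫ x, G x * φ (x - t • e) ∂μ) volume 0 τ := by
    rw [intervalIntegrable_iff_integrableOn_Ioc_of_le hτ]
    have := hint2.integral_prod_left
    simp only [hrest (fun x => G (x + _ • e))] at this
    simp only [htr]
    exact this
  have hftc := intervalIntegral.integral_eq_sub_of_hasDerivAt (fun t _ => hder t) hv
  rw [intervalIntegral.integral_of_le hτ] at hftc
  simp only [htr, zero_smul, sub_zero] at hftc
  have hsw := integral_integral_swap (f := fun s x => G (x + s • e) * φ x) hint2
  simp only [integral_mul_const, hrest (fun x => G (x + _ • e)),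
    hrest (fun x => ∫ s in Set.Ioc 0 τ, G (x + s • e))] at hsw
  rw [hsw] at hftc
  have e1 : ∀ x, φ x • (F (x + τ • e) - F x) = F (x + τ • e) * φ x - F x * φ x :=
    fun x => by simp only [smul_eq_mul]; ring
  have e2 : ∀ x, φ x • ∫ s in (0 : ℝ)..τ, G (x + s • e)
      = (∫ s in Set.Ioc 0 τ, G (x + s • e)) * φ x := fun x => by
    rw [intervalIntegral.integral_of_le hτ, smul_eq_mul, mul_comm]
  simp only [e1, e2]
  rw [integral_sub, hftc]
  · exact (locallyIntegrable_translate hF (τ • e)).integrable_smul_right_of_hasCompactSupport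
      hφ1 hφc
  · exact hF.integrable_smul_right_of_hasCompactSupport hφ1 hφc

end Shift

/-! ### The one-dimensional Gaussian Poincaré inequality. -/

section Poincare

lemma sq_lintegral_le {α : Type*} [MeasurableSpace α] (μ : Measure α) {F : α → ℝ≥0∞}
    (hF : AEMeasurable F μ) : (∫⁻ x, F x ∂μ) ^ 2 ≤ μ Set.univ * ∫⁻ x, F x ^ 2 ∂μ := by
  have h := ENNReal.lintegral_mul_le_Lp_mul_Lq μ Real.HolderConjugate.two_two
    (f := fun _ => 1) (g := F) aemeasurable_const hF
  simp only [Pi.mul_apply, one_mul, lintegral_const, ENNReal.rpow_two,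
    one_pow] at h
  calc (∫⁻ x, F x ∂μ) ^ 2
      ≤ (μ Set.univ ^ (1 / 2 : ℝ) * (∫⁻ x, F x ^ 2 ∂μ) ^ (1 / 2 : ℝ)) ^ 2 := by gcongr
    _ = _ := by
      rw [mul_pow, ← ENNReal.rpow_natCast, ← ENNReal.rpow_natCast, ← ENNReal.rpow_mul,
        ← ENNReal.rpow_mul]
      norm_num

/-- Cauchy–Schwarz. On an interval the mass is its length; for a probability measure the factor is 1
and this is Jensen's inequality. -/
lemma enorm_integral_sq_le {α : Type*} [MeasurableSpace α] (μ : Measure α) {f : α → ℝ}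
    (hf : AEMeasurable f μ) :
    ‖∫ x, f x ∂μ‖ₑ ^ 2 ≤ μ Set.univ * ∫⁻ x, ‖f x‖ₑ ^ 2 ∂μ :=
  le_trans (by gcongr; exact enorm_integral_le_lintegral_enorm f) (sq_lintegral_le μ hf.enorm)

variable {v : ℝ≥0}

lemma hasDerivAt_gaussianPDFReal (hv : v ≠ 0) (x : ℝ) :
    HasDerivAt (fun x => -(v * gaussianPDFReal 0 v x)) (gaussianPDFReal 0 v x * x) x := by
  have hv' : (v : ℝ) ≠ 0 := by exact_mod_cast hv
  have h1 : HasDerivAt (fun x : ℝ => -(x - 0) ^ 2 / (2 * v)) (-x / v) x := by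
    have := ((((hasDerivAt_id x).sub_const 0).pow 2).neg).div_const (2 * (v : ℝ))
    refine this.congr_deriv ?_
    simp
    field_simp
  have h2 := ((h1.exp.const_mul (√(2 * Real.pi * v))⁻¹).const_mul (v : ℝ)).neg
  refine h2.congr_deriv ?_
  simp only [gaussianPDFReal]
  field_simp

lemma tendsto_gaussianPDFReal_atTop (hv : v ≠ 0) :
    Tendsto (gaussianPDFReal 0 v) atTop (𝓝 0) := by
  have hv' : (0 : ℝ) < v := by exact_mod_cast pos_iff_ne_zero.2 hv
  have h1 : Tendsto (fun x : ℝ => -(x - 0) ^ 2 / (2 * v)) atTop atBot := by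
    simp only [sub_zero, neg_div]
    refine tendsto_neg_atTop_atBot.comp ?_
    exact (tendsto_pow_atTop two_ne_zero).atTop_div_const (by positivity)
  have := (Real.tendsto_exp_atBot.comp h1).const_mul (√(2 * Real.pi * v))⁻¹
  simpa [gaussianPDFReal_def, Function.comp_def] using this

lemma setIntegral_Ici_id_gaussianReal (hv : v ≠ 0) (t : ℝ) :
    ∫ x in Set.Ici t, x ∂(gaussianReal 0 v) = v * gaussianPDFReal 0 v t := by
  have hint : Integrable (fun x : ℝ => gaussianPDFReal 0 v x * x) := by
    have h := (memLp_id_gaussianReal' (μ := 0) (v := v) 1 (by simp)).integrable le_rfl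
    rw [gaussianReal_of_var_ne_zero _ hv, integrable_withDensity_iff
      (measurable_gaussianPDF _ _) (ae_of_all _ fun _ => gaussianPDF_lt_top)] at h
    simpa [toReal_gaussianPDF, mul_comm] using h
  rw [← integral_indicator measurableSet_Ici, integral_gaussianReal_eq_integral_smul hv]
  have h1 : ∀ x, gaussianPDFReal 0 v x • (Set.Ici t).indicator (fun x => x) x
      = (Set.Ici t).indicator (fun x => gaussianPDFReal 0 v x * x) x := fun x => by
    by_cases hx : x ∈ Set.Ici t <;> simp [hx]
  simp only [h1]
  rw [integral_indicator measurableSet_Ici, integral_Ici_eq_integral_Ioi,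
    integral_Ioi_of_hasDerivAt_of_tendsto' (m := 0)
      (fun x _ => hasDerivAt_gaussianPDFReal hv x) hint.integrableOn]
  · simp
  · simpa using ((tendsto_gaussianPDFReal_atTop hv).const_mul (v : ℝ)).neg

/-- For independent $a,b$ this computes $E[(b-a)1_{a<t\le b}]$. Since the law is centred,
$E[a;a<t]=-E[b;b\ge t]=-v\,p(t)$, and the two products recombine because $P(a<t)+P(b\ge t)=1$. It is
the kernel left after Fubini in the Poincaré inequality. -/
lemma lintegral_sub_gaussianReal (hv : v ≠ 0) (t : ℝ) :
    ∫⁻ p in Set.Iio t ×ˢ Set.Ici t, ENNReal.ofReal (p.2 - p.1)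
      ∂((gaussianReal 0 v).prod (gaussianReal 0 v)) = v * gaussianPDF 0 v t := by
  set γ := gaussianReal 0 v
  have hid : Integrable (fun x : ℝ => x) γ :=
    (memLp_id_gaussianReal' (μ := 0) (v := v) 1 (by simp)).integrable le_rfl
  have h1 : Integrable (fun p : ℝ × ℝ => p.1) (γ.prod γ) := hid.comp_fst γ
  have h2 : Integrable (fun p : ℝ × ℝ => p.2) (γ.prod γ) := hid.comp_snd γ
  have hms : MeasurableSet (Set.Iio t ×ˢ Set.Ici t) := measurableSet_Iio.prod measurableSet_Ici
  rw [← ofReal_integral_eq_lintegral_ofReal (f := fun p : ℝ × ℝ => p.2 - p.1)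
    (h2.sub h1).integrableOn
    ((ae_restrict_iff' hms).2 (ae_of_all _ fun p hp => by
      have h3 : p.1 < t := hp.1
      have h4 : t ≤ p.2 := hp.2
      simp only [Pi.zero_apply]; linarith))]
  have e1 := setIntegral_prod_mul (μ := γ) (ν := γ) (fun _ : ℝ => (1 : ℝ)) (fun x : ℝ => x)
    (Set.Iio t) (Set.Ici t)
  have e2 := setIntegral_prod_mul (μ := γ) (ν := γ) (fun x : ℝ => x) (fun _ : ℝ => (1 : ℝ))
    (Set.Iio t) (Set.Ici t)
  have e3 : ∫ x in Set.Iio t, x ∂γ = - ∫ x in Set.Ici t, x ∂γ := by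
    have := integral_add_compl (measurableSet_Ici (a := t)) hid
    rw [Set.compl_Ici, integral_id_gaussianReal] at this
    linarith
  have e4 : γ.real (Set.Iio t) + γ.real (Set.Ici t) = 1 := by
    have := probReal_add_probReal_compl (μ := γ) (measurableSet_Ici (a := t))
    rw [Set.compl_Ici] at this
    linarith
  simp only [one_mul, mul_one, integral_const, smul_eq_mul, measureReal_restrict_apply_univ] at e1 e2
  rw [integral_sub h2.integrableOn h1.integrableOn, e1, e2, e3, setIntegral_Ici_id_gaussianReal hv]
  have e5 : γ.real (Set.Iio t) * (v * gaussianPDFReal 0 v t)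
      - -(v * gaussianPDFReal 0 v t) * γ.real (Set.Ici t) = v * gaussianPDFReal 0 v t := by
    linear_combination (v * gaussianPDFReal 0 v t) * e4
  rw [e5, ENNReal.ofReal_mul (by positivity), ENNReal.ofReal_coe_nnreal]
  rfl

/-- The Gaussian Poincaré inequality, for the mean square difference of two independent copies. -/
theorem lintegral_sq_sub_le_gaussianReal (hv : v ≠ 0) {f g : ℝ → ℝ} (hf : Measurable f)
    (hg : Measurable g)
    (h : ∀ᵐ a ∂(gaussianReal 0 v), ∀ᵐ b ∂(gaussianReal 0 v),
      a ≤ b → f b - f a = ∫ t in a..b, g t) :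
    ∫⁻ a, ∫⁻ b, ‖f a - f b‖ₑ ^ 2 ∂(gaussianReal 0 v) ∂(gaussianReal 0 v)
      ≤ 2 * v * ∫⁻ t, ‖g t‖ₑ ^ 2 ∂(gaussianReal 0 v) := by
  set γ := gaussianReal 0 v with hγ
  set k : ℝ → ℝ → ℝ≥0∞ := fun a b => (Set.Ici a).indicator (fun b => ‖f b - f a‖ₑ ^ 2) b with hk
  have hle : MeasurableSet {p : ℝ × ℝ | p.1 ≤ p.2} := measurableSet_le measurable_fst measurable_snd
  have hkm : Measurable (Function.uncurry k) := by
    have : Function.uncurry k = Set.indicator {p : ℝ × ℝ | p.1 ≤ p.2}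
        (fun p => ‖f p.2 - f p.1‖ₑ ^ 2) := by
      ext ⟨a, b⟩
      simp [hk, Function.uncurry, Set.indicator]
    rw [this]
    exact Measurable.indicator (by fun_prop) hle
  -- The line formula is only assumed for ordered endpoints; the symmetry of the product measure
  -- makes the two orderings contribute equally, whence the factor 2.
  have hsplit : ∀ a b, ‖f a - f b‖ₑ ^ 2 ≤ k a b + k b a := by
    intro a b
    rcases le_total a b with hab | hab
    · simp only [hk, Set.indicator_of_mem (Set.mem_Ici.2 hab)]
      rw [← enorm_neg, neg_sub]
      exact le_self_add
    · simp only [hk, Set.indicator_of_mem (Set.mem_Ici.2 hab)]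
      exact le_add_self
  set D : Set ((ℝ × ℝ) × ℝ) := {q | q.1.1 < q.2 ∧ q.2 ≤ q.1.2} with hD
  have hDm : MeasurableSet D :=
    (measurableSet_lt (f := fun q : (ℝ × ℝ) × ℝ => q.1.1) (g := fun q => q.2)
      (by fun_prop) (by fun_prop)).inter
      (measurableSet_le (f := fun q : (ℝ × ℝ) × ℝ => q.2) (g := fun q => q.1.2)
        (by fun_prop) (by fun_prop))
  set L : (ℝ × ℝ) × ℝ → ℝ≥0∞ := D.indicator
    (fun q => ENNReal.ofReal (q.1.2 - q.1.1) * ‖g q.2‖ₑ ^ 2) with hL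
  have hLm : Measurable L := Measurable.indicator (by fun_prop) hDm
  -- Cauchy–Schwarz on $(a,b]$: $|f(b)-f(a)|^2\le(b-a)\int_a^b g^2$.
  have hkL : ∀ a b, (a ≤ b → f b - f a = ∫ t in a..b, g t) → k a b ≤ ∫⁻ t, L ((a, b), t) := by
    intro a b hab
    by_cases hle : a ≤ b
    · simp only [hk, Set.indicator_of_mem (Set.mem_Ici.2 hle)]
      rw [hab hle, intervalIntegral.integral_of_le hle]
      refine (enorm_integral_sq_le _ hg.aemeasurable).trans (le_of_eq ?_)
      have : ∀ t, L ((a, b), t)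
          = (Set.Ioc a b).indicator (fun t => ENNReal.ofReal (b - a) * ‖g t‖ₑ ^ 2) t := by
        intro t
        simp [hL, hD, Set.indicator]
      simp only [this]
      rw [lintegral_indicator measurableSet_Ioc, lintegral_const_mul _ (by fun_prop)]
      simp
    · simp [hk, hle]
  calc ∫⁻ a, ∫⁻ b, ‖f a - f b‖ₑ ^ 2 ∂γ ∂γ
      ≤ ∫⁻ a, ∫⁻ b, (k a b + k b a) ∂γ ∂γ :=
        lintegral_mono fun a => lintegral_mono fun b => hsplit a b
    _ = 2 * ∫⁻ a, ∫⁻ b, k a b ∂γ ∂γ := by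
        have hm1 : ∀ a, Measurable (fun b => k a b) := fun a => hkm.comp measurable_prodMk_left
        simp only [lintegral_add_left (hm1 _)]
        rw [lintegral_add_left (f := fun a => ∫⁻ b, k a b ∂γ) hkm.lintegral_prod_right', lintegral_lintegral_swap
          (f := fun a b => k b a) (hkm.comp measurable_swap).aemeasurable, two_mul]
    _ ≤ 2 * ∫⁻ a, ∫⁻ b, (∫⁻ t, L ((a, b), t)) ∂γ ∂γ := by
        refine mul_le_mul_right ?_ 2
        refine lintegral_mono_ae (h.mono fun a ha => lintegral_mono_ae (ha.mono fun b hb => ?_))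
        exact hkL a b hb
    _ = 2 * ∫⁻ p, (∫⁻ t, L (p, t)) ∂(γ.prod γ) := by
        rw [lintegral_prod _ hLm.lintegral_prod_right'.aemeasurable]
    _ = 2 * ∫⁻ t, ∫⁻ p, L (p, t) ∂(γ.prod γ) := by
        rw [lintegral_lintegral_swap (f := fun p t => L (p, t)) hLm.aemeasurable]
    _ = 2 * ∫⁻ t, (v * gaussianPDF 0 v t) * ‖g t‖ₑ ^ 2 := by
        congr 1
        refine lintegral_congr fun t => ?_
        rw [← lintegral_sub_gaussianReal hv t, ← lintegral_mul_const _ (by fun_prop),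
          ← lintegral_indicator (measurableSet_Iio.prod measurableSet_Ici)]
        refine lintegral_congr fun p => ?_
        simp [hL, hD, Set.indicator]
    _ = 2 * v * ∫⁻ t, ‖g t‖ₑ ^ 2 ∂γ := by
        rw [hγ, gaussianReal_of_var_ne_zero _ hv,
          lintegral_withDensity_eq_lintegral_mul _ (measurable_gaussianPDF _ _) (by fun_prop)]
        simp only [Pi.mul_apply, mul_assoc]
        rw [lintegral_const_mul]
        exact (measurable_gaussianPDF _ _).mul (by fun_prop)

end Poincare

/-! ### Product measures, partial averages and conditional expectation. -/

section Pi

set_option linter.unusedSectionVars false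

lemma absolutelyContinuous_pi_fin {n : ℕ} (μ ν : Fin n → Measure ℝ) [∀ i, SigmaFinite (μ i)]
    [∀ i, SigmaFinite (ν i)] (h : ∀ i, μ i ≪ ν i) : Measure.pi μ ≪ Measure.pi ν := by
  induction n with
  | zero =>
    rw [Measure.pi_of_empty, Measure.pi_of_empty]
  | succ n ih =>
    have h1 := (measurePreserving_piFinSuccAbove μ 0).symm
    have h2 := (measurePreserving_piFinSuccAbove ν 0).symm
    rw [← h1.map_eq, ← h2.map_eq]
    exact ((h 0).prod (ih _ _ fun i => h _)).map (MeasurableEquiv.measurable _)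

variable {ι : Type*} [Fintype ι] [DecidableEq ι]

lemma measurable_piecewise_prod (s : Finset ι) :
    Measurable (fun p : (ι → ℝ) × (ι → ℝ) => s.piecewise p.1 p.2) := by
  refine measurable_pi_iff.2 fun j => ?_
  by_cases hj : j ∈ s <;> simp only [Finset.piecewise, hj, if_true, if_false] <;> fun_prop

lemma measurable_update_prod (l : ι) :
    Measurable (fun p : (ι → ℝ) × ℝ => Function.update p.1 l p.2) := by
  refine measurable_pi_iff.2 fun j => ?_
  by_cases hj : j = l
  · subst hj; simp only [Function.update_self]; fun_prop
  · simp only [Function.update_of_ne hj]; fun_prop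

variable (ν : ι → Measure ℝ) [∀ i, IsProbabilityMeasure (ν i)]

/-- Resampling the coordinates outside `s` from an independent copy keeps the law. This reduces
integrability, the tower property and $L^2$ contraction of `partialAvg` to Fubini on a product of
two copies. -/
lemma measurePreserving_piecewise (s : Finset ι) :
    MeasurePreserving (fun p : (ι → ℝ) × (ι → ℝ) => s.piecewise p.1 p.2)
      ((Measure.pi ν).prod (Measure.pi ν)) (Measure.pi ν) := by
  refine ⟨measurable_piecewise_prod s, (Measure.pi_eq fun t ht => ?_).symm⟩
  rw [Measure.map_apply (measurable_piecewise_prod s) (MeasurableSet.univ_pi ht)]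
  have : (fun p : (ι → ℝ) × (ι → ℝ) => s.piecewise p.1 p.2) ⁻¹' (Set.univ.pi t)
      = (Set.univ.pi fun j => if j ∈ s then t j else Set.univ) ×ˢ
        (Set.univ.pi fun j => if j ∈ s then Set.univ else t j) := by
    ext p
    simp only [Set.mem_preimage, Set.mem_univ_pi, Set.mem_prod, ← forall_and, Finset.piecewise]
    refine forall_congr' fun j => ?_
    by_cases hj : j ∈ s <;> simp [hj]
  rw [this, Measure.prod_prod, Measure.pi_pi, Measure.pi_pi, ← Finset.prod_mul_distrib]
  refine Finset.prod_congr rfl fun j _ => ?_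
  by_cases hj : j ∈ s <;> simp [hj]

lemma measurePreserving_update (l : ι) :
    MeasurePreserving (fun p : (ι → ℝ) × ℝ => Function.update p.1 l p.2)
      ((Measure.pi ν).prod (ν l)) (Measure.pi ν) := by
  refine ⟨measurable_update_prod l, (Measure.pi_eq fun t ht => ?_).symm⟩
  rw [Measure.map_apply (measurable_update_prod l) (MeasurableSet.univ_pi ht)]
  have : (fun p : (ι → ℝ) × ℝ => Function.update p.1 l p.2) ⁻¹' (Set.univ.pi t)
      = (Set.univ.pi (Function.update t l Set.univ)) ×ˢ t l := by
    ext p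
    simp only [Set.mem_preimage, Set.mem_univ_pi, Set.mem_prod]
    constructor
    · refine fun h => ⟨fun j => ?_, by simpa using h l⟩
      by_cases hj : j = l
      · subst hj; simp
      · simpa [Function.update_of_ne hj] using h j
    · rintro ⟨h1, h2⟩ j
      by_cases hj : j = l
      · subst hj; simpa using h2
      · simpa [Function.update_of_ne hj] using h1 j
  rw [this, Measure.prod_prod, Measure.pi_pi, ← Finset.mul_prod_erase _ _ (Finset.mem_univ l),
    ← Finset.mul_prod_erase _ (fun i => ν i (t i)) (Finset.mem_univ l), Function.update_self,
    measure_univ, one_mul, mul_comm]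
  congr 1
  refine Finset.prod_congr rfl fun j hj => ?_
  rw [Function.update_of_ne (Finset.ne_of_mem_erase hj)]

/-- The average of `f` over the coordinates outside `s`. -/
noncomputable def partialAvg (s : Finset ι) (f : (ι → ℝ) → ℝ) (x : ι → ℝ) : ℝ :=
  ∫ y, f (s.piecewise x y) ∂(Measure.pi ν)

variable {ν} {f g : (ι → ℝ) → ℝ}

lemma measurable_partialAvg (s : Finset ι) (hf : Measurable f) :
    Measurable (partialAvg ν s f) :=
  ((hf.comp (measurable_piecewise_prod s)).stronglyMeasurable.integral_prod_right').measurable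

lemma integrable_comp_piecewise (s : Finset ι) (hf : Integrable f (Measure.pi ν)) :
    Integrable (fun p : (ι → ℝ) × (ι → ℝ) => f (s.piecewise p.1 p.2))
      ((Measure.pi ν).prod (Measure.pi ν)) :=
  (measurePreserving_piecewise ν s).integrable_comp_of_integrable hf

lemma ae_integrable_slice (s : Finset ι) (hf : Integrable f (Measure.pi ν)) :
    ∀ᵐ x ∂(Measure.pi ν), Integrable (fun y => f (s.piecewise x y)) (Measure.pi ν) :=
  (integrable_comp_piecewise s hf).prod_right_ae

lemma integrable_partialAvg (s : Finset ι) (hf : Integrable f (Measure.pi ν)) :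
    Integrable (partialAvg ν s f) (Measure.pi ν) :=
  (integrable_comp_piecewise s hf).integral_prod_left

lemma integral_partialAvg (s : Finset ι) (hf : Integrable f (Measure.pi ν)) :
    ∫ x, partialAvg ν s f x ∂(Measure.pi ν) = ∫ x, f x ∂(Measure.pi ν) := by
  have h1 := integral_prod _ (integrable_comp_piecewise s hf)
  have h2 := integral_map (measurePreserving_piecewise ν s).aemeasurable (f := f) (by
    rw [(measurePreserving_piecewise ν s).map_eq]; exact hf.aestronglyMeasurable)
  rw [(measurePreserving_piecewise ν s).map_eq] at h2
  rw [h2, h1]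
  rfl

lemma piecewise_piecewise_eq (s t : Finset ι) (x y z : ι → ℝ) :
    t.piecewise (s.piecewise x y) z = (s ∩ t).piecewise x (t.piecewise y z) := by
  ext j
  by_cases h1 : j ∈ s <;> by_cases h2 : j ∈ t <;> simp [Finset.piecewise, h1, h2]

/-- The tower property: two successive resamplings fix only the coordinates in both sets, and by
independence the order is irrelevant. -/
lemma partialAvg_partialAvg (s t : Finset ι) (hf : Integrable f (Measure.pi ν)) :
    partialAvg ν s (partialAvg ν t f) =ᵐ[Measure.pi ν] partialAvg ν (s ∩ t) f := by
  filter_upwards [ae_integrable_slice (s ∩ t) hf] with x hx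
  have h1 := (measurePreserving_piecewise ν t).integrable_comp_of_integrable hx
  have h2 := integral_prod _ h1
  have h3 := integral_map (measurePreserving_piecewise ν t).aemeasurable
    (f := fun y => f ((s ∩ t).piecewise x y)) (by
      rw [(measurePreserving_piecewise ν t).map_eq]; exact hx.aestronglyMeasurable)
  rw [(measurePreserving_piecewise ν t).map_eq] at h3
  simp only [partialAvg, piecewise_piecewise_eq]
  rw [h3]
  exact h2.symm

/-- Averages over coordinates outside `s` only depend on the coordinates in any larger set. -/
lemma partialAvg_piecewise {s u : Finset ι} (hsu : s ⊆ u) (x y : ι → ℝ) :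
    partialAvg ν s f (u.piecewise x y) = partialAvg ν s f x := by
  unfold partialAvg
  congr 1
  ext z
  congr 1
  ext j
  by_cases hj : j ∈ s
  · simp [Finset.piecewise, hj, hsu hj]
  · simp [Finset.piecewise, hj]

lemma partialAvg_compl_singleton (hf : Measurable f) (l : ι) (x : ι → ℝ) :
    partialAvg ν {l}ᶜ f x = ∫ a, f (Function.update x l a) ∂(ν l) := by
  rw [← (measurePreserving_eval ν l).map_eq, integral_map (μ := Measure.pi ν) (φ := (Function.eval l : (ι → ℝ) → ℝ))
    (measurable_pi_apply l).aemeasurable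
    (f := fun a : ℝ => f (Function.update x l a)) ((hf.comp ((measurable_update_prod l).comp measurable_prodMk_left)).aestronglyMeasurable)]
  unfold partialAvg
  congr 1
  ext y
  congr 1
  ext j
  by_cases hj : j = l
  · subst hj; simp [Finset.piecewise]
  · simp [Finset.piecewise, hj]

lemma partialAvg_univ (x : ι → ℝ) : partialAvg ν Finset.univ f x = f x := by
  simp [partialAvg]

lemma partialAvg_empty (x : ι → ℝ) : partialAvg ν ∅ f x = ∫ y, f y ∂(Measure.pi ν) := by
  simp [partialAvg]

lemma lintegral_lintegral_piecewise (s : Finset ι) {k : (ι → ℝ) → ℝ≥0∞} (hk : Measurable k) :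
    ∫⁻ x, ∫⁻ y, k (s.piecewise x y) ∂(Measure.pi ν) ∂(Measure.pi ν)
      = ∫⁻ x, k x ∂(Measure.pi ν) := by
  rw [← (measurePreserving_piecewise ν s).lintegral_comp hk, lintegral_prod]
  exact (hk.comp (measurable_piecewise_prod s)).aemeasurable

lemma lintegral_lintegral_update (l : ι) {k : (ι → ℝ) → ℝ≥0∞} (hk : Measurable k) :
    ∫⁻ x, ∫⁻ a, k (Function.update x l a) ∂(ν l) ∂(Measure.pi ν)
      = ∫⁻ x, k x ∂(Measure.pi ν) := by
  rw [← (measurePreserving_update ν l).lintegral_comp hk, lintegral_prod]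
  exact (hk.comp (measurable_update_prod l)).aemeasurable

lemma lintegral_partialAvg_sq_le (s : Finset ι) (hf : Measurable f) :
    ∫⁻ x, ‖partialAvg ν s f x‖ₑ ^ 2 ∂(Measure.pi ν) ≤ ∫⁻ x, ‖f x‖ₑ ^ 2 ∂(Measure.pi ν) := by
  rw [← lintegral_lintegral_piecewise s (k := fun x => ‖f x‖ₑ ^ 2) (by fun_prop)]
  refine lintegral_mono fun x => ?_
  refine (enorm_integral_sq_le _ (hf.comp
    ((measurable_piecewise_prod s).comp measurable_prodMk_left)).aemeasurable).trans ?_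
  simp

variable {Ω : Type*} [MeasurableSpace Ω] {P : Measure Ω}

/-- Writes the σ-algebra as generated by a single map, so that its sets are preimages under that
map; the value 0 outside `s` is a placeholder carrying no information. -/
lemma iSup_comap_eq_comap_piecewise (V : Ω → ι → ℝ) (s : Finset ι) :
    (⨆ (j : ι) (_ : j ∈ s), MeasurableSpace.comap (fun ω => V ω j) inferInstance)
      = MeasurableSpace.comap (fun ω => s.piecewise (V ω) 0) MeasurableSpace.pi := by
  apply le_antisymm
  · refine iSup₂_le fun j hj => ?_
    have : (fun ω => V ω j) = (fun x : ι → ℝ => x j) ∘ (fun ω => s.piecewise (V ω) 0) := by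
      ext ω; simp [hj]
    rw [this, ← MeasurableSpace.comap_comp]
    exact MeasurableSpace.comap_mono (measurable_pi_apply j).comap_le
  · rw [MeasurableSpace.pi, MeasurableSpace.comap_iSup]
    refine iSup_le fun j => ?_
    rw [MeasurableSpace.comap_comp]
    by_cases hj : j ∈ s
    · have : (fun x : ι → ℝ => x j) ∘ (fun ω => s.piecewise (V ω) 0) = fun ω => V ω j := by
        ext ω; simp [hj]
      rw [this]
      exact le_iSup₂_of_le j hj le_rfl
    · have : (fun x : ι → ℝ => x j) ∘ (fun ω => s.piecewise (V ω) 0) = fun _ => 0 := by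
        ext ω; simp [hj]
      rw [this, MeasurableSpace.comap_const]
      exact bot_le

/-- For independent coordinates, conditioning on the coordinates in `s` averages over the others. -/
theorem condExp_comp_eq_partialAvg [IsProbabilityMeasure P] {V : Ω → ι → ℝ} (hVm : Measurable V)
    (hV : P.map V = Measure.pi ν) (s : Finset ι) (hfm : Measurable f)
    (hf : Integrable f (Measure.pi ν)) :
    P[fun ω => f (V ω) | ⨆ (j : ι) (_ : j ∈ s), MeasurableSpace.comap (fun ω => V ω j) inferInstance]
      =ᵐ[P] fun ω => partialAvg ν s f (V ω) := by
  rw [iSup_comap_eq_comap_piecewise]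
  have hVp : MeasurePreserving V P (Measure.pi ν) := ⟨hVm, hV⟩
  have hpm : Measurable (fun x : ι → ℝ => s.piecewise x 0) :=
    (measurable_piecewise_prod s).comp (by fun_prop : Measurable fun x : ι → ℝ => (x, (0 : ι → ℝ)))
  have hA := integrable_partialAvg s hf
  have hAm := measurable_partialAvg (ν := ν) s hfm
  refine (ae_eq_condExp_of_forall_setIntegral_eq (hpm.comp hVm).comap_le
    (hVp.integrable_comp_of_integrable hf)
    (fun _ _ _ => (hVp.integrable_comp_of_integrable hA).integrableOn) ?_ ?_).symm
  · rintro _ ⟨S, hS, rfl⟩ -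
    set S' := (fun x : ι → ℝ => s.piecewise x 0) ⁻¹' S with hS'
    have hS'm : MeasurableSet S' := hpm hS
    change ∫ ω in V ⁻¹' S', partialAvg ν s f (V ω) ∂P = ∫ ω in V ⁻¹' S', f (V ω) ∂P
    have tr : ∀ k : (ι → ℝ) → ℝ, Measurable k → ∫ ω in V ⁻¹' S', k (V ω) ∂P
        = ∫ x, S'.indicator k x ∂(Measure.pi ν) := fun k hk => by
      rw [← hV, integral_indicator hS'm, setIntegral_map hS'm hk.aestronglyMeasurable
        hVm.aemeasurable]
    rw [tr _ hAm, tr _ hfm, ← integral_partialAvg s (hf.indicator hS'm)]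
    congr 1
    ext x
    -- Membership in `S'` ignores the coordinates outside `s`, so its indicator passes through the
    -- partial average.
    have hmem : ∀ y, s.piecewise x y ∈ S' ↔ x ∈ S' := fun y => by
      simp only [hS', Set.mem_preimage]
      have : s.piecewise (s.piecewise x y) 0 = s.piecewise x (0 : ι → ℝ) := by
        ext j; by_cases hj : j ∈ s <;> simp [hj]
      rw [this]
    by_cases hx : x ∈ S'
    · simp [partialAvg, hx, hmem]
    · simp [partialAvg, hx, hmem]
  · refine (StronglyMeasurable.aestronglyMeasurable ?_)
    refine Measurable.stronglyMeasurable ?_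
    have : partialAvg ν s f ∘ V
        = (partialAvg ν s f) ∘ (fun ω => s.piecewise (V ω) 0) := by
      ext ω
      simp [partialAvg_piecewise subset_rfl]
    rw [this]
    exact hAm.comp (comap_measurable _)

end Pi

/-! ### Derivatives along coordinate lines and the Poincaré inequality in one coordinate. -/

section CoordinatePoincare

/-- The centred Gaussian product measure with variance `v` in each coordinate. -/
noncomputable abbrev gaussianPi (N : ℕ) (v : ℝ≥0) : Measure (Fin N → ℝ) :=
  Measure.pi fun _ => gaussianReal 0 v

variable {N : ℕ} {v : ℝ≥0} {F G G' : (Fin N → ℝ) → ℝ} {l : Fin N}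

/-- `G` is the derivative of `F` along almost every line parallel to the `l`-th axis. -/
def IsLineDeriv (v : ℝ≥0) (l : Fin N) (F G : (Fin N → ℝ) → ℝ) : Prop :=
  ∀ᵐ x ∂(gaussianPi N v), ∀ᵐ a ∂(gaussianReal 0 v), ∀ᵐ b ∂(gaussianReal 0 v),
    a ≤ b → F (Function.update x l b) - F (Function.update x l a)
      = ∫ t in a..b, G (Function.update x l t)

lemma gaussianPi_absolutelyContinuous (hv : v ≠ 0) : gaussianPi N v ≪ volume :=
  absolutelyContinuous_pi_fin _ _ fun _ => gaussianReal_absolutelyContinuous 0 hv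

lemma absolutelyContinuous_gaussianPi (hv : v ≠ 0) :
    (volume : Measure (Fin N → ℝ)) ≪ gaussianPi N v :=
  absolutelyContinuous_pi_fin _ _ fun _ => gaussianReal_absolutelyContinuous' 0 hv

lemma update_add_smul_single (x : Fin N → ℝ) (l : Fin N) (a s : ℝ) :
    Function.update x l a + s • (Pi.single l 1 : Fin N → ℝ) = Function.update x l (a + s) := by
  ext j
  by_cases hj : j = l
  · subst hj; simp
  · simp [hj]

/-- Makes the exceptional set in `isLineDeriv_of_isWeakPartialDeriv` measurable, as the exchange of
almost-everywhere quantifiers there requires. -/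
lemma measurable_integral_line (hG : Measurable G) (l : Fin N) :
    Measurable (fun p : ((Fin N → ℝ) × ℝ) × ℝ =>
      ∫ s in Set.Ioc 0 p.2, G (Function.update p.1.1 l (p.1.2 + s))) := by
  have hD : MeasurableSet {q : (((Fin N → ℝ) × ℝ) × ℝ) × ℝ | 0 < q.2 ∧ q.2 ≤ q.1.2} :=
    (measurableSet_lt measurable_const measurable_snd).inter
      (measurableSet_le measurable_snd (by fun_prop))
  have hm : Measurable (fun q : (((Fin N → ℝ) × ℝ) × ℝ) × ℝ =>
      G (Function.update q.1.1.1 l (q.1.1.2 + q.2))) :=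
    hG.comp ((measurable_update_prod l).comp (by fun_prop :
      Measurable fun q : (((Fin N → ℝ) × ℝ) × ℝ) × ℝ => (q.1.1.1, q.1.1.2 + q.2)))
  have := (hm.indicator hD).stronglyMeasurable.integral_prod_right' (ν := volume)
  convert this.measurable using 2 with p
  rw [← integral_indicator measurableSet_Ioc]
  rfl

theorem isLineDeriv_of_isWeakPartialDeriv (hv : v ≠ 0) (hF : Measurable F) (hG : Measurable G)
    (h : IsWeakPartialDeriv l 1 F G) : IsLineDeriv v l F G := by
  obtain ⟨hFl, hGl, hw⟩ := h
  have h1 : ∀ τ : ℝ, 0 ≤ τ → ∀ᵐ x ∂(gaussianPi N v),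
      F (x + τ • (Pi.single l 1 : Fin N → ℝ)) - F x
        = ∫ s in (0 : ℝ)..τ, G (x + s • (Pi.single l 1 : Fin N → ℝ)) := fun τ hτ =>
    (gaussianPi_absolutelyContinuous hv).ae_le (ae_shift_sub_eq_integral _ hG hFl hGl
      (fun φ hφ hφc => by simpa [partialDeriv] using hw φ hφ hφc) τ hτ)
  set Q : ((Fin N → ℝ) × ℝ) × ℝ → Prop := fun p =>
    0 ≤ p.2 → F (Function.update p.1.1 l (p.1.2 + p.2)) - F (Function.update p.1.1 l p.1.2)
      = ∫ s in Set.Ioc 0 p.2, G (Function.update p.1.1 l (p.1.2 + s)) with hQ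
  have hQm : MeasurableSet {p | Q p} := by
    have e : {p | Q p} = {p | 0 ≤ p.2}ᶜ ∪ {p | F (Function.update p.1.1 l (p.1.2 + p.2))
        - F (Function.update p.1.1 l p.1.2)
        = ∫ s in Set.Ioc 0 p.2, G (Function.update p.1.1 l (p.1.2 + s))} := by
      ext p
      simp only [hQ, Set.mem_ofPred_eq, Set.mem_union, Set.mem_compl_iff, imp_iff_not_or]
    rw [e]
    refine (measurableSet_le measurable_const measurable_snd).compl.union
      (measurableSet_eq_fun (Measurable.sub ?_ ?_) (measurable_integral_line hG l))
    · exact hF.comp ((measurable_update_prod l).comp (by fun_prop :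
        Measurable fun q : ((Fin N → ℝ) × ℝ) × ℝ => (q.1.1, q.1.2 + q.2)))
    · exact hF.comp ((measurable_update_prod l).comp (by fun_prop :
        Measurable fun q : ((Fin N → ℝ) × ℝ) × ℝ => (q.1.1, q.1.2)))
  have h2 : ∀ τ : ℝ, ∀ᵐ p ∂((gaussianPi N v).prod (gaussianReal 0 v)), Q (p, τ) := by
    intro τ
    by_cases hτ : 0 ≤ τ
    · filter_upwards [(measurePreserving_update (fun _ => gaussianReal 0 v)
        l).quasiMeasurePreserving.ae (h1 τ hτ)] with p hp _
      simpa only [update_add_smul_single, intervalIntegral.integral_of_le hτ] using hp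
    · exact ae_of_all _ fun p hp => absurd hp hτ
  -- The exceptional set of points depends on the shift; Fubini turns "every shift, almost every
  -- point" into "almost every point, almost every shift".
  have h3 : ∀ᵐ p ∂((gaussianPi N v).prod (gaussianReal 0 v)), ∀ᵐ τ : ℝ, Q (p, τ) :=
    (Measure.ae_ae_comm (μ := (gaussianPi N v).prod (gaussianReal 0 v))
      (ν := (volume : Measure ℝ)) (p := fun p τ => Q (p, τ)) hQm).2 (ae_of_all _ h2)
  filter_upwards [Measure.ae_ae_of_ae_prod h3] with x hx
  filter_upwards [hx] with a ha
  -- Gaussian null sets may be replaced by Lebesgue ones, which are translation invariant; the shift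
  -- `τ` then becomes the endpoint `b = a + τ`.
  refine (gaussianReal_absolutelyContinuous 0 hv).ae_le ?_
  filter_upwards [(measurePreserving_sub_right volume a).quasiMeasurePreserving.ae ha] with b hb hab
  have h4 := hb (sub_nonneg.2 hab)
  simp only [add_sub_cancel] at h4
  rw [h4, ← intervalIntegral.integral_of_le (sub_nonneg.2 hab),
    intervalIntegral.integral_comp_add_left (fun t => G (Function.update x l t)) a]
  simp

/-- The Gaussian Poincaré inequality in one coordinate. -/
theorem lintegral_sq_sub_partialAvg_le (hv : v ≠ 0) (hF : Measurable F) (hG : Measurable G)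
    (hFi : Integrable F (gaussianPi N v)) (h : IsLineDeriv v l F G) :
    ∫⁻ x, ‖F x - partialAvg (fun _ => gaussianReal 0 v) {l}ᶜ F x‖ₑ ^ 2 ∂(gaussianPi N v)
      ≤ 2 * v * ∫⁻ x, ‖G x‖ₑ ^ 2 ∂(gaussianPi N v) := by
  have hFu : ∀ x, Measurable (fun a => F (Function.update x l a)) := fun x =>
    hF.comp ((measurable_update_prod l).comp measurable_prodMk_left)
  have hGu : ∀ x, Measurable (fun a => G (Function.update x l a)) := fun x =>
    hG.comp ((measurable_update_prod l).comp measurable_prodMk_left)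
  have hsl : ∀ᵐ x ∂(gaussianPi N v),
      Integrable (fun a => F (Function.update x l a)) (gaussianReal 0 v) :=
    ((measurePreserving_update (fun _ => gaussianReal 0 v) l).integrable_comp_of_integrable
      hFi).prod_right_ae
  have hk : Measurable (fun x => ∫⁻ b, ‖F x - F (Function.update x l b)‖ₑ ^ 2
      ∂(gaussianReal 0 v)) := by
    have : Measurable (fun p : (Fin N → ℝ) × ℝ => ‖F p.1 - F (Function.update p.1 l p.2)‖ₑ ^ 2) :=
      ((hF.comp measurable_fst).sub (hF.comp (measurable_update_prod l))).enorm.pow_const 2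
    exact this.lintegral_prod_right'
  calc ∫⁻ x, ‖F x - partialAvg (fun _ => gaussianReal 0 v) {l}ᶜ F x‖ₑ ^ 2 ∂(gaussianPi N v)
      ≤ ∫⁻ x, ∫⁻ b, ‖F x - F (Function.update x l b)‖ₑ ^ 2 ∂(gaussianReal 0 v)
          ∂(gaussianPi N v) := by
        refine lintegral_mono_ae (hsl.mono fun x hx => ?_)
        -- Jensen against an independent copy of the coordinate. This costs a factor 2 compared with
        -- the variance identity, which is harmless for the rate.
        have e : F x - partialAvg (fun _ => gaussianReal 0 v) {l}ᶜ F x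
            = ∫ b, (F x - F (Function.update x l b)) ∂(gaussianReal 0 v) := by
          rw [partialAvg_compl_singleton hF, integral_sub (integrable_const _) hx]
          simp
        rw [e]
        refine (enorm_integral_sq_le _ (measurable_const.sub (hFu x)).aemeasurable).trans ?_
        simp
    _ = ∫⁻ x, ∫⁻ a, ∫⁻ b, ‖F (Function.update x l a) - F (Function.update x l b)‖ₑ ^ 2
          ∂(gaussianReal 0 v) ∂(gaussianReal 0 v) ∂(gaussianPi N v) := by
        rw [← lintegral_lintegral_update l hk]
        simp only [Function.update_idem]
    _ ≤ ∫⁻ x, 2 * v * ∫⁻ a, ‖G (Function.update x l a)‖ₑ ^ 2 ∂(gaussianReal 0 v)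
          ∂(gaussianPi N v) :=
        lintegral_mono_ae (h.mono fun x hx =>
          lintegral_sq_sub_le_gaussianReal hv (hFu x) (hGu x) hx)
    _ = 2 * v * ∫⁻ x, ‖G x‖ₑ ^ 2 ∂(gaussianPi N v) := by
        rw [lintegral_const_mul, lintegral_lintegral_update l (k := fun x => ‖G x‖ₑ ^ 2)
          (by fun_prop)]
        exact Measurable.lintegral_prod_right' (f := fun p : (Fin N → ℝ) × ℝ =>
          ‖G (Function.update p.1 l p.2)‖ₑ ^ 2)
          ((hG.comp (measurable_update_prod l)).enorm.pow_const 2)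

/-- The Gaussian density is continuous and positive, so dividing by it preserves integrability on
bounded intervals. -/
lemma intervalIntegrable_of_integrable_gaussianReal (hv : v ≠ 0) {g : ℝ → ℝ}
    (hg : Integrable g (gaussianReal 0 v)) (a b : ℝ) : IntervalIntegrable g volume a b := by
  rw [gaussianReal_of_var_ne_zero _ hv, integrable_withDensity_iff
    (measurable_gaussianPDF _ _) (ae_of_all _ fun _ => gaussianPDF_lt_top)] at hg
  simp only [toReal_gaussianPDF] at hg
  have hc : Continuous (gaussianPDFReal 0 v) := by
    rw [gaussianPDFReal_def]; fun_prop
  have hc' : Continuous fun x => (gaussianPDFReal 0 v x)⁻¹ :=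
    hc.inv₀ fun x => (gaussianPDFReal_pos 0 v x hv).ne'
  have := (hg.intervalIntegrable (a := a) (b := b)).mul_continuousOn hc'.continuousOn
  refine this.congr fun x _ => ?_
  simp [(gaussianPDFReal_pos 0 v x hv).ne']

lemma update_eq_piecewise (x : Fin N → ℝ) (l : Fin N) (a : ℝ) :
    Function.update x l a = ({l}ᶜ : Finset (Fin N)).piecewise x (fun _ => a) := by
  ext j
  by_cases hj : j = l
  · subst hj; simp
  · simp [hj]

/-- Along a line in direction `l` the factor `C` is constant, so the subtracted term is linear there
with slope `C`. -/
lemma IsLineDeriv.sub_mul (hv : v ≠ 0) (hGi : Integrable G (gaussianPi N v))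
    (h : IsLineDeriv v l F G) {C : (Fin N → ℝ) → ℝ}
    (hC : ∀ x a, C (Function.update x l a) = C x) :
    IsLineDeriv v l (fun x => F x - C x * x l) (fun x => G x - C x) := by
  have hsl : ∀ᵐ x ∂(gaussianPi N v),
      Integrable (fun a => G (Function.update x l a)) (gaussianReal 0 v) :=
    ((measurePreserving_update (fun _ => gaussianReal 0 v) l).integrable_comp_of_integrable
      hGi).prod_right_ae
  filter_upwards [h, hsl] with x hx hxi
  filter_upwards [hx] with a ha
  filter_upwards [ha] with b hb hab
  simp only [hC, Function.update_self]
  rw [intervalIntegral.integral_sub (intervalIntegrable_of_integrable_gaussianReal hv hxi a b)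
    (by simp), ← hb hab]
  simp
  ring

end CoordinatePoincare

/-! ### Orthogonal decomposition of the error on Gaussian space. -/

section Decomposition

lemma lintegral_enorm_sq_lt_top {α : Type*} [MeasurableSpace α] {μ : Measure α} {f : α → ℝ}
    (hf : MemLp f 2 μ) : ∫⁻ x, ‖f x‖ₑ ^ 2 ∂μ < ∞ := by
  have := lintegral_rpow_enorm_lt_top_of_eLpNorm_lt_top two_ne_zero ENNReal.ofNat_ne_top hf.2
  simpa using this

lemma memLp_two_of_lintegral_lt_top {α : Type*} [MeasurableSpace α] {μ : Measure α} {f : α → ℝ}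
    (hf : AEStronglyMeasurable f μ) (h : ∫⁻ x, ‖f x‖ₑ ^ 2 ∂μ < ∞) : MemLp f 2 μ :=
  ⟨hf, (eLpNorm_lt_top_iff_lintegral_rpow_enorm_lt_top two_ne_zero ENNReal.ofNat_ne_top).2
    (by simpa using h)⟩

lemma lintegral_enorm_sq_eq_ofReal {α : Type*} [MeasurableSpace α] {μ : Measure α} {f : α → ℝ}
    (hf : MemLp f 2 μ) : ∫⁻ x, ‖f x‖ₑ ^ 2 ∂μ = ENNReal.ofReal (∫ x, f x ^ 2 ∂μ) := by
  rw [ofReal_integral_eq_lintegral_ofReal hf.integrable_sq (ae_of_all _ fun x => sq_nonneg _)]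
  refine lintegral_congr fun x => ?_
  rw [← ofReal_norm, ← ENNReal.ofReal_pow (norm_nonneg _), Real.norm_eq_abs, sq_abs]

lemma lintegral_sum_sq_eq_of_orthogonal {α ι : Type*} [MeasurableSpace α] {μ : Measure α}
    [Fintype ι] {D : ι → α → ℝ} (hD : ∀ i, MemLp (D i) 2 μ)
    (h : ∀ i j, i ≠ j → ∫ x, D i x * D j x ∂μ = 0) :
    ∫⁻ x, ‖∑ i, D i x‖ₑ ^ 2 ∂μ = ∑ i, ∫⁻ x, ‖D i x‖ₑ ^ 2 ∂μ := by
  have hint : ∀ i j, Integrable (fun x => D i x * D j x) μ := fun i j =>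
    (hD i).integrable_mul (hD j)
  rw [lintegral_enorm_sq_eq_ofReal (memLp_finsetSum _ fun i _ => hD i)]
  simp only [lintegral_enorm_sq_eq_ofReal (hD _)]
  rw [← ENNReal.ofReal_sum_of_nonneg fun i _ => integral_nonneg fun x => sq_nonneg _]
  congr 1
  simp only [sq, Finset.sum_mul_sum]
  rw [integral_finsetSum _ fun i _ => integrable_finsetSum _ fun j _ => hint i j]
  refine Finset.sum_congr rfl fun i _ => ?_
  rw [integral_finsetSum _ fun j _ => hint i j]
  exact Finset.sum_eq_single i (fun j _ hj => h i j hj.symm) (by simp)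

variable {N : ℕ} {v : ℝ≥0} {F G G' : (Fin N → ℝ) → ℝ} {l : Fin N}

local notation "γ" => gaussianReal 0 v

/-- The average over the coordinates with index at least `k`. -/
noncomputable def pastAvg (v : ℝ≥0) (k : ℕ) (f : (Fin N → ℝ) → ℝ) : (Fin N → ℝ) → ℝ :=
  partialAvg (fun _ => gaussianReal 0 v) (Finset.univ.filter fun j : Fin N => (j : ℕ) < k) f

/-- The martingale difference of `F` at step `l`, less its first order approximation. -/
noncomputable def remainder (v : ℝ≥0) (l : Fin N) (F G : (Fin N → ℝ) → ℝ) (x : Fin N → ℝ) : ℝ :=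
  pastAvg v (l + 1) F x - pastAvg v l F x - pastAvg v l G x * x l

lemma measurable_pastAvg (k : ℕ) (hF : Measurable F) : Measurable (pastAvg v k F) :=
  measurable_partialAvg _ hF

lemma measurable_remainder (hF : Measurable F) (hG : Measurable G) :
    Measurable (remainder v l F G) :=
  ((measurable_pastAvg _ hF).sub (measurable_pastAvg _ hF)).sub
    ((measurable_pastAvg _ hG).mul (measurable_pi_apply l))

lemma memLp_coord (l : Fin N) : MemLp (fun x : Fin N → ℝ => x l) 2 (gaussianPi N v) :=
  (memLp_id_gaussianReal' (μ := 0) (v := v) 2 (by simp)).comp_measurePreserving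
    (measurePreserving_eval (fun _ : Fin N => γ) l)

lemma integral_coord (l : Fin N) : ∫ x, x l ∂(gaussianPi N v) = 0 := by
  have := integral_map (μ := gaussianPi N v) (φ := (Function.eval l : (Fin N → ℝ) → ℝ))
    (measurable_pi_apply l).aemeasurable (f := fun a : ℝ => a) (by fun_prop)
  rw [(measurePreserving_eval (fun _ : Fin N => γ) l).map_eq, integral_id_gaussianReal] at this
  exact this.symm

lemma memLp_partialAvg (s : Finset (Fin N)) (hFm : Measurable F)
    (hF : MemLp F 2 (gaussianPi N v)) : MemLp (partialAvg (fun _ => γ) s F) 2 (gaussianPi N v) :=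
  memLp_two_of_lintegral_lt_top (measurable_partialAvg s hFm).aestronglyMeasurable
    ((lintegral_partialAvg_sq_le s hFm).trans_lt (lintegral_enorm_sq_lt_top hF))

lemma filter_lt_succ_inter_compl (l : Fin N) :
    (Finset.univ.filter fun j : Fin N => (j : ℕ) < l + 1) ∩ {l}ᶜ
      = Finset.univ.filter fun j : Fin N => (j : ℕ) < l := by
  ext j
  simp only [Finset.mem_inter, Finset.mem_filter, Finset.mem_univ, true_and, Finset.mem_compl,
    Finset.mem_singleton, Fin.ext_iff]
  omega

lemma filter_lt_subset {k m : ℕ} (h : k ≤ m) :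
    (Finset.univ.filter fun j : Fin N => (j : ℕ) < k)
      ⊆ Finset.univ.filter fun j : Fin N => (j : ℕ) < m := by
  intro j
  simp only [Finset.mem_filter, Finset.mem_univ, true_and]
  omega

/-- Averaging over `x l` and then over the later coordinates is averaging over all coordinates from
`l` on, so the two past averages in `remainder` factor through the present one. The whole remainder
is thus one conditional expectation, and contraction applies. -/
lemma remainder_ae_eq (hGm : Measurable G)
    (hF : MemLp F 2 (gaussianPi N v)) (hG : MemLp G 2 (gaussianPi N v)) :
    remainder v l F G =ᵐ[gaussianPi N v] partialAvg (fun _ => γ)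
      (Finset.univ.filter fun j : Fin N => (j : ℕ) < l + 1)
      (fun x => F x - partialAvg (fun _ => γ) {l}ᶜ G x * x l - partialAvg (fun _ => γ) {l}ᶜ F x) := by
  set u := Finset.univ.filter fun j : Fin N => (j : ℕ) < l + 1 with hu
  have hlu : l ∈ u := by simp [hu]
  have hFi := hF.integrable (by norm_num)
  have hGi := hG.integrable (by norm_num)
  have hC := memLp_partialAvg {l}ᶜ hGm hG
  have h1 := partialAvg_partialAvg u {l}ᶜ hFi
  have h2 := partialAvg_partialAvg u {l}ᶜ hGi
  rw [hu, filter_lt_succ_inter_compl] at h1 h2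
  filter_upwards [h1, h2, ae_integrable_slice u hFi,
    ae_integrable_slice u (hC.integrable_mul (memLp_coord l)),
    ae_integrable_slice u (integrable_partialAvg {l}ᶜ hFi)] with x e1 e2 i1 i2 i3
  simp only [Pi.mul_apply] at i2
  rw [remainder, pastAvg, pastAvg, pastAvg, ← e1, ← e2]
  conv_rhs => rw [partialAvg]
  have i4 : Integrable (fun y => F (u.piecewise x y)
      - partialAvg (fun _ => γ) {l}ᶜ G (u.piecewise x y) * u.piecewise x y l)
      (gaussianPi N v) := i1.sub i2
  rw [integral_sub i4 i3, integral_sub i1 i2]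
  simp only [Finset.piecewise_eq_of_mem _ _ _ hlu, integral_mul_const]
  rw [sub_right_comm]
  rfl

lemma lintegral_remainder_sq_le (hv : v ≠ 0) (hFm : Measurable F) (hGm : Measurable G)
    (hGm' : Measurable G') (hF : MemLp F 2 (gaussianPi N v)) (hG : MemLp G 2 (gaussianPi N v))
    (hFG : IsLineDeriv v l F G) (hGG' : IsLineDeriv v l G G') :
    ∫⁻ x, ‖remainder v l F G x‖ₑ ^ 2 ∂(gaussianPi N v)
      ≤ 4 * v ^ 2 * ∫⁻ x, ‖G' x‖ₑ ^ 2 ∂(gaussianPi N v) := by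
  have hFi := hF.integrable (by norm_num)
  have hGi := hG.integrable (by norm_num)
  set C := partialAvg (fun _ => γ) {l}ᶜ G with hCdef
  have hC : MemLp C 2 (gaussianPi N v) := memLp_partialAvg {l}ᶜ hGm hG
  have hCm : Measurable C := measurable_partialAvg _ hGm
  have hCinv : ∀ x a, C (Function.update x l a) = C x := fun x a => by
    rw [update_eq_piecewise, hCdef, partialAvg_piecewise subset_rfl]
  set F' : (Fin N → ℝ) → ℝ := fun x => F x - C x * x l with hF'
  have hF'm : Measurable F' := hFm.sub (hCm.mul (measurable_pi_apply l))
  have hF'i : Integrable F' (gaussianPi N v) := hFi.sub (hC.integrable_mul (memLp_coord l))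
  have hsl : ∀ᵐ x ∂(gaussianPi N v), Integrable (fun a => F (Function.update x l a)) γ :=
    ((measurePreserving_update (fun _ => γ) l).integrable_comp_of_integrable hFi).prod_right_ae
  -- `C` does not depend on `x l`, which has mean zero, so the subtracted term averages to 0.
  have hAF : ∀ᵐ x ∂(gaussianPi N v),
      partialAvg (fun _ => γ) {l}ᶜ F' x = partialAvg (fun _ => γ) {l}ᶜ F x := by
    filter_upwards [hsl] with x hx
    rw [partialAvg_compl_singleton hF'm, partialAvg_compl_singleton hFm]
    simp only [hF', hCinv, Function.update_self]
    rw [integral_sub hx, integral_const_mul, integral_id_gaussianReal, mul_zero, sub_zero]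
    exact ((memLp_id_gaussianReal' (μ := 0) (v := v) 1 (by simp)).integrable le_rfl).const_mul _
  calc ∫⁻ x, ‖remainder v l F G x‖ₑ ^ 2 ∂(gaussianPi N v)
      = ∫⁻ x, ‖partialAvg (fun _ => γ) (Finset.univ.filter fun j : Fin N => (j : ℕ) < l + 1)
          (fun x => F' x - partialAvg (fun _ => γ) {l}ᶜ F x) x‖ₑ ^ 2 ∂(gaussianPi N v) :=
        lintegral_congr_ae ((remainder_ae_eq (l := l) hGm hF hG).mono fun x hx => by
          simp only [hx, hF', hCdef])
    _ ≤ ∫⁻ x, ‖F' x - partialAvg (fun _ => γ) {l}ᶜ F x‖ₑ ^ 2 ∂(gaussianPi N v) :=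
        lintegral_partialAvg_sq_le _ (hF'm.sub (measurable_partialAvg _ hFm))
    _ = ∫⁻ x, ‖F' x - partialAvg (fun _ => γ) {l}ᶜ F' x‖ₑ ^ 2 ∂(gaussianPi N v) :=
        lintegral_congr_ae (hAF.mono fun x hx => by simp only [hx])
    _ ≤ 2 * v * ∫⁻ x, ‖G x - C x‖ₑ ^ 2 ∂(gaussianPi N v) :=
        lintegral_sq_sub_partialAvg_le hv hF'm (hGm.sub hCm) hF'i (hFG.sub_mul hv hGi hCinv)
    _ ≤ 2 * v * (2 * v * ∫⁻ x, ‖G' x‖ₑ ^ 2 ∂(gaussianPi N v)) := by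
        gcongr
        exact lintegral_sq_sub_partialAvg_le hv hGm hGm' hGi hGG'
    _ = 4 * v ^ 2 * ∫⁻ x, ‖G' x‖ₑ ^ 2 ∂(gaussianPi N v) := by ring

/-- The martingale difference property: the first two terms have the same past average by the tower
property, and in the third a function of the past multiplies the centred coordinate `x l`. -/
lemma pastAvg_remainder_ae_eq_zero (hF : MemLp F 2 (gaussianPi N v))
    (hG : MemLp G 2 (gaussianPi N v)) (hGm : Measurable G) :
    pastAvg v l (remainder v l F G) =ᵐ[gaussianPi N v] 0 := by
  set s := Finset.univ.filter fun j : Fin N => (j : ℕ) < l with hs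
  set u := Finset.univ.filter fun j : Fin N => (j : ℕ) < l + 1 with hu
  have hls : l ∉ s := by simp [hs]
  have hsu : s ∩ u = s := Finset.inter_eq_left.2 (filter_lt_subset (Nat.le_succ _))
  have hFi := hF.integrable (by norm_num)
  have h1 := partialAvg_partialAvg s u hFi
  have h2 := partialAvg_partialAvg s s hFi
  rw [hsu] at h1
  rw [Finset.inter_self] at h2
  filter_upwards [h1, h2, ae_integrable_slice s (integrable_partialAvg u hFi),
    ae_integrable_slice s (integrable_partialAvg s hFi),
    ae_integrable_slice s ((memLp_partialAvg s hGm hG).integrable_mul (memLp_coord l))]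
    with x e1 e2 i1 i2 i3
  simp only [Pi.mul_apply] at i3
  have i4 : Integrable (fun y => partialAvg (fun _ => γ) u F (s.piecewise x y)
      - partialAvg (fun _ => γ) s F (s.piecewise x y)) (gaussianPi N v) := i1.sub i2
  change ∫ y, (partialAvg (fun _ => γ) u F (s.piecewise x y)
    - partialAvg (fun _ => γ) s F (s.piecewise x y)
    - partialAvg (fun _ => γ) s G (s.piecewise x y) * s.piecewise x y l) ∂(gaussianPi N v) = 0
  rw [integral_sub i4 i3, integral_sub i1 i2]
  have e3 : ∀ y, partialAvg (fun _ => γ) s G (s.piecewise x y) * s.piecewise x y l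
      = partialAvg (fun _ => γ) s G x * y l := fun y => by
    rw [partialAvg_piecewise subset_rfl, Finset.piecewise_eq_of_notMem _ _ _ hls]
  simp only [e3]
  rw [integral_const_mul, integral_coord, mul_zero, sub_zero]
  exact sub_eq_zero.2 (e1.trans e2.symm)

/-- The earlier remainder depends only on coordinates below `l`, so it factors out of the average
over the others, which annihilates the later remainder. -/
lemma integral_remainder_mul_eq_zero {k : Fin N} (hkl : k < l) {H : (Fin N → ℝ) → ℝ}
    (hF : MemLp F 2 (gaussianPi N v)) (hG : MemLp G 2 (gaussianPi N v)) (hGm : Measurable G)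
    (hl : MemLp (remainder v l F G) 2 (gaussianPi N v))
    (hk : MemLp (remainder v k F H) 2 (gaussianPi N v)) :
    ∫ x, remainder v l F G x * remainder v k F H x ∂(gaussianPi N v) = 0 := by
  have hkl' : (k : ℕ) < l := hkl
  change ∫ x, (remainder v l F G * remainder v k F H) x ∂(gaussianPi N v) = 0
  rw [← integral_partialAvg (Finset.univ.filter fun j : Fin N => (j : ℕ) < l)
    (hl.integrable_mul hk)]
  refine integral_eq_zero_of_ae ?_
  filter_upwards [pastAvg_remainder_ae_eq_zero (l := l) hF hG hGm] with x hx
  have hinv : ∀ y, remainder v k F H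
      ((Finset.univ.filter fun j : Fin N => (j : ℕ) < l).piecewise x y) = remainder v k F H x := by
    intro y
    simp only [remainder, pastAvg]
    rw [partialAvg_piecewise (filter_lt_subset hkl'), partialAvg_piecewise
      (filter_lt_subset hkl'.le), partialAvg_piecewise (filter_lt_subset hkl'.le),
      Finset.piecewise_eq_of_mem _ _ _ (by simpa using hkl)]
  simp only [partialAvg, Pi.mul_apply, hinv, integral_mul_const]
  have hx' : ∫ y, remainder v l F G
      ((Finset.univ.filter fun j : Fin N => (j : ℕ) < l).piecewise x y) ∂(gaussianPi N v) = 0 := hx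
  rw [hx', zero_mul]
  rfl

/-- Telescoping of the past averages, from the mean at `k = 0` to `F` itself at `k = N`. -/
lemma sub_approx_eq_sum_remainder (G : Fin N → (Fin N → ℝ) → ℝ) (x : Fin N → ℝ) :
    F x - (∫ y, F y ∂(gaussianPi N v) + ∑ l : Fin N, pastAvg v l (G l) x * x l)
      = ∑ l : Fin N, remainder v l F (G l) x := by
  have h1 := Fin.sum_univ_eq_sum_range (fun k => pastAvg v (k + 1) F x - pastAvg v k F x) N
  rw [Finset.sum_range_sub (fun k => pastAvg v k F x)] at h1
  have h2 : pastAvg v N F x = F x := by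
    have : (Finset.univ.filter fun j : Fin N => (j : ℕ) < N) = Finset.univ := by ext j; simp
    rw [pastAvg, this, partialAvg_univ]
  have h3 : pastAvg v 0 F x = ∫ y, F y ∂(gaussianPi N v) := by
    simp [pastAvg, partialAvg_empty]
  simp only [remainder]
  rw [Finset.sum_sub_distrib, h1, h2, h3]
  ring

/-- The mean square error of the first order discrete Clark-Ocone formula on Gaussian space. -/
theorem lintegral_sub_approx_sq_le (hv : v ≠ 0) {G G' : Fin N → (Fin N → ℝ) → ℝ}
    (hFm : Measurable F) (hGm : ∀ l, Measurable (G l)) (hGm' : ∀ l, Measurable (G' l))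
    (hF : MemLp F 2 (gaussianPi N v)) (hG : ∀ l, MemLp (G l) 2 (gaussianPi N v))
    (hG' : ∀ l, MemLp (G' l) 2 (gaussianPi N v))
    (hFG : ∀ l, IsLineDeriv v l F (G l)) (hGG' : ∀ l, IsLineDeriv v l (G l) (G' l)) :
    ∫⁻ x, ‖F x - (∫ y, F y ∂(gaussianPi N v) + ∑ l : Fin N, pastAvg v l (G l) x * x l)‖ₑ ^ 2
        ∂(gaussianPi N v)
      ≤ 4 * v ^ 2 * ∑ l, ∫⁻ x, ‖G' l x‖ₑ ^ 2 ∂(gaussianPi N v) := by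
  have hle := fun l => lintegral_remainder_sq_le hv hFm (hGm l) (hGm' l) hF (hG l) (hFG l) (hGG' l)
  have hD : ∀ l, MemLp (remainder v l F (G l)) 2 (gaussianPi N v) := fun l =>
    memLp_two_of_lintegral_lt_top (measurable_remainder hFm (hGm l)).aestronglyMeasurable
      ((hle l).trans_lt (ENNReal.mul_lt_top (ENNReal.mul_lt_top (by simp)
        (ENNReal.pow_lt_top ENNReal.coe_lt_top)) (lintegral_enorm_sq_lt_top (hG' l))))
  simp only [sub_approx_eq_sum_remainder]
  rw [lintegral_sum_sq_eq_of_orthogonal hD, Finset.mul_sum]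
  · exact Finset.sum_le_sum fun l _ => hle l
  · intro i j hij
    rcases lt_or_gt_of_ne hij with h | h
    · simp only [mul_comm (remainder v i F (G i) _)]
      exact integral_remainder_mul_eq_zero h hF (hG j) (hGm j) (hD j) (hD i)
    · exact integral_remainder_mul_eq_zero h hF (hG i) (hGm i) (hD i) (hD j)

end Decomposition

/-! ### Transfer from Gaussian space to functionals of the Brownian increments. -/

section BrownianIncrements

set_option linter.unusedSectionVars false

lemma eLpNorm_two_sq {α : Type*} [MeasurableSpace α] (μ : Measure α) (f : α → ℝ) :
    eLpNorm f 2 μ ^ 2 = ∫⁻ x, ‖f x‖ₑ ^ 2 ∂μ := by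
  have := eLpNorm_nnreal_pow_eq_lintegral (f := f) (μ := μ) (p := 2) two_ne_zero
  simpa using this

lemma gridPoint_succ_sub (T : ℝ) (N k : ℕ) :
    gridPoint T N (k + 1) - gridPoint T N k = T / N := by
  simp only [gridPoint]; push_cast; ring

lemma gridPoint_mono {T : ℝ} (hT : 0 ≤ T) (N : ℕ) : Monotone (gridPoint T N) := by
  intro a b hab
  have : (a : ℝ) ≤ b := by exact_mod_cast hab
  unfold gridPoint
  gcongr

lemma gridPoint_mem_Icc {T : ℝ} (hT : 0 ≤ T) {N k : ℕ} (hN : 1 ≤ N) (hk : k ≤ N) :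
    gridPoint T N k ∈ Set.Icc 0 T := by
  have h0 : gridPoint T N 0 = 0 := by simp [gridPoint]
  have h1 : gridPoint T N N = T := by
    have : (N : ℝ) ≠ 0 := by positivity
    simp only [gridPoint]; field_simp
  exact ⟨h0 ▸ gridPoint_mono hT N (Nat.zero_le k), (gridPoint_mono hT N hk).trans_eq h1⟩

variable {Ω : Type*} [MeasurableSpace Ω] {P : Measure Ω} [IsProbabilityMeasure P]
  {T : ℝ} {W : ℝ → Ω → ℝ} {N : ℕ}

/-- The vector of all increments. -/
noncomputable def incrVec (T : ℝ) (W : ℝ → Ω → ℝ) (N : ℕ) (ω : Ω) : Fin N → ℝ :=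
  fun j => incr T W N j ω

lemma measurePreserving_incrVec (hT : 0 < T) (hW : IsBrownianMotionOn T W P) (hN : 1 ≤ N) :
    MeasurePreserving (incrVec T W N) P (gaussianPi N (T / N).toNNReal) := by
  have hmem : ∀ k : ℕ, k ≤ N → gridPoint T N k ∈ Set.Icc 0 T := fun k =>
    gridPoint_mem_Icc hT.le hN
  have hlaw : ∀ l : Fin N, HasLaw (incr T W N l) (gaussianReal 0 (T / N).toNNReal) P := by
    intro l
    have := hW.law_increments (gridPoint T N l) (gridPoint T N (l + 1))
      (hmem l l.2.le).1 (gridPoint_mono hT.le N (Nat.le_succ _)) (hmem (l + 1) l.2).2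
    rw [gridPoint_succ_sub] at this
    exact this
  have hind : iIndepFun (incr T W N) P := by
    have := hW.indep_increments N
      (fun i => ⟨gridPoint T N i, hmem i (Nat.lt_succ_iff.1 i.2)⟩)
      (fun i j hij => gridPoint_mono hT.le N hij)
    exact this
  refine ⟨measurable_pi_iff.2 fun l => ?_, ((iIndepFun_iff_hasLaw_pi_pi hlaw).1 hind).map_eq⟩
  exact (hW.measurable _ (hmem (l + 1) l.2)).sub (hW.measurable _ (hmem l l.2.le))

lemma functionalDeriv_spec {X : Ω → ℝ} {n : ℕ} (hX : MemD T W P N n X) (l : Fin N) {m : ℕ}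
    (h1 : 1 ≤ m) (hm : m ≤ n) :
    MemLp (functionalDeriv T W P l m X) 2 P ∧
      IsFunctionalDeriv T W P l m X (functionalDeriv T W P l m X) := by
  have h := hX.2.2 l m h1 hm
  rw [functionalDeriv, dif_pos h]
  exact h.choose_spec

lemma IsWeakPartialDeriv.congr_ae {l : Fin N} {m : ℕ} {F F' G : (Fin N → ℝ) → ℝ}
    (h : IsWeakPartialDeriv l m F G) (hF : F =ᵐ[volume] F') : IsWeakPartialDeriv l m F' G := by
  refine ⟨h.1.congr hF, h.2.1, fun φ hφ hφc => ?_⟩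
  rw [← h.2.2 φ hφ hφc]
  exact integral_congr_ae (hF.mono fun x hx => by simp only [hx])

lemma contDiff_partialDeriv {l : Fin N} {φ : (Fin N → ℝ) → ℝ}
    (hφ : ContDiff ℝ ((⊤ : ℕ∞) : WithTop ℕ∞) φ) :
    ContDiff ℝ ((⊤ : ℕ∞) : WithTop ℕ∞) (partialDeriv l φ) :=
  (hφ.fderiv_right (m := ((⊤ : ℕ∞) : WithTop ℕ∞)) (by simp)).clm_apply contDiff_const

lemma hasCompactSupport_partialDeriv {l : Fin N} {φ : (Fin N → ℝ) → ℝ}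
    (hφ : HasCompactSupport φ) : HasCompactSupport (partialDeriv l φ) :=
  (hφ.fderiv (𝕜 := ℝ)).comp_left (g := fun L : (Fin N → ℝ) →L[ℝ] ℝ => L (Pi.single l 1)) (by simp)

/-- The second weak derivative is the weak derivative of the first one. -/
lemma IsWeakPartialDeriv.of_second {l : Fin N} {F G G' : (Fin N → ℝ) → ℝ}
    (h : IsWeakPartialDeriv l 1 F G) (h' : IsWeakPartialDeriv l 2 F G') :
    IsWeakPartialDeriv l 1 G G' := by
  refine ⟨h.2.1, h'.2.1, fun φ hφ hφc => ?_⟩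
  have h1 := h.2.2 _ (contDiff_partialDeriv (l := l) hφ) (hasCompactSupport_partialDeriv hφc)
  have h2 := h'.2.2 φ hφ hφc
  simp only [Function.iterate_succ, Function.iterate_zero, Function.comp_apply, id_eq, pow_one,
    neg_mul, one_mul, even_two, Even.neg_pow, one_pow] at h1 h2 ⊢
  linarith

lemma sigmaIncr_eq (k : ℕ) :
    sigmaIncr T W N k = ⨆ (j : Fin N) (_ : j ∈ Finset.univ.filter fun j : Fin N => (j : ℕ) < k),
      MeasurableSpace.comap (fun ω => incrVec T W N ω j) inferInstance := by
  simp only [Finset.mem_filter, Finset.mem_univ, true_and]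
  rfl

/-- The process is constant in time on each cell of length `T / N`, so the left side is its integral
over the union of the cells. That union omits only the endpoint `T`, and the inequality suffices. -/
lemma sum_eLpNorm_sq_le_lintegral_malliavinDeriv (hT : 0 < T) (hN : 1 ≤ N) (m : ℕ) (X : Ω → ℝ) :
    (T / N).toNNReal * ∑ l : Fin N, eLpNorm (functionalDeriv T W P l m X) 2 P ^ 2
      ≤ ∫⁻ t in Set.Icc (0 : ℝ) T, eLpNorm (malliavinDeriv T W P N m X t) 2 P ^ 2 := by
  set cell : Fin N → Set ℝ := fun l => Set.Ico (gridPoint T N l) (gridPoint T N (l + 1)) with hcell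
  have hdisj : Pairwise (Function.onFun Disjoint cell) := by
    intro i j hij
    refine Set.disjoint_left.2 fun t hi hj => ?_
    rcases lt_or_gt_of_ne hij with h | h
    · exact absurd (hi.2.trans_le ((gridPoint_mono hT.le N (Nat.succ_le_of_lt h)).trans hj.1))
        (lt_irrefl _)
    · exact absurd (hj.2.trans_le ((gridPoint_mono hT.le N (Nat.succ_le_of_lt h)).trans hi.1))
        (lt_irrefl _)
  have hval : ∀ l, ∀ t ∈ cell l,
      malliavinDeriv T W P N m X t = functionalDeriv T W P l m X := by
    intro l t ht
    ext ω
    rw [malliavinDeriv, Finset.sum_eq_single l]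
    · exact Set.indicator_of_mem ht _
    · intro j _ hj
      exact Set.indicator_of_notMem (fun h => (Set.disjoint_left.1 (hdisj hj)) h ht) _
    · simp
  have hsub : (⋃ l, cell l) ⊆ Set.Icc 0 T := Set.iUnion_subset fun l t ht =>
    ⟨(gridPoint_mem_Icc hT.le hN l.2.le).1.trans ht.1,
      ht.2.le.trans (gridPoint_mem_Icc hT.le hN (Nat.succ_le_of_lt l.2)).2⟩
  calc (T / N).toNNReal * ∑ l : Fin N, eLpNorm (functionalDeriv T W P l m X) 2 P ^ 2
      = ∑ l : Fin N, ∫⁻ t in cell l, eLpNorm (malliavinDeriv T W P N m X t) 2 P ^ 2 := by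
        rw [Finset.mul_sum]
        refine Finset.sum_congr rfl fun l _ => ?_
        rw [setLIntegral_congr_fun (g := fun _ => eLpNorm (functionalDeriv T W P l m X) 2 P ^ 2)
          measurableSet_Ico (fun t ht => by simp only [hval l t ht]), setLIntegral_const,
          Real.volume_Ico, gridPoint_succ_sub, mul_comm]
        rfl
    _ = ∫⁻ t in ⋃ l, cell l, eLpNorm (malliavinDeriv T W P N m X t) 2 P ^ 2 := by
        rw [lintegral_iUnion (fun l => measurableSet_Ico) hdisj, tsum_fintype]
    _ ≤ _ := lintegral_mono_set hsub

theorem eLpNorm_sub_clarkOconeApprox_sq_le (hT : 0 < T) (hW : IsBrownianMotionOn T W P)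
    (hN : 1 ≤ N) {X : Ω → ℝ} (hX : MemD T W P N 2 X) :
    AEStronglyMeasurable (fun ω => X ω - clarkOconeApprox T W P N X ω) P ∧
    eLpNorm (fun ω => X ω - clarkOconeApprox T W P N X ω) 2 P ^ 2
      ≤ 4 * (T / N).toNNReal *
        ∫⁻ t in Set.Icc (0 : ℝ) T, eLpNorm (malliavinDeriv T W P N 2 X t) 2 P ^ 2 := by
  set v := (T / N).toNNReal with hvdef
  have hN' : (0 : ℝ) < N := by exact_mod_cast hN
  have hv : v ≠ 0 := (Real.toNNReal_pos.2 (div_pos hT hN')).ne'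
  have hV := measurePreserving_incrVec hT hW hN
  rw [← hvdef] at hV
  have hsp1 := fun l => functionalDeriv_spec hX l le_rfl one_le_two
  have hsp2 := fun l => functionalDeriv_spec hX l one_le_two le_rfl
  choose hL1 hD1 using hsp1
  choose hL2 hD2 using hsp2
  choose F₁ G₁ mF₁ mG₁ eF₁ eG₁ w₁ using hD1
  choose F₂ G₂ mF₂ mG₂ eF₂ eG₂ w₂ using hD2
  -- Each derivative comes with its own representative of `X`; the one for index 0, which exists
  -- since `1 ≤ N`, is kept for all.
  set F := F₁ ⟨0, hN⟩ with hF
  have hFm : Measurable F := mF₁ _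
  have hXF : X =ᵐ[P] fun ω => F (incrVec T W N ω) := eF₁ _
  -- Representatives agree almost everywhere for the Gaussian law, hence for Lebesgue measure, which
  -- is what weak derivatives see.
  have huniq : ∀ {H : (Fin N → ℝ) → ℝ}, Measurable H →
      X =ᵐ[P] (fun ω => H (incrVec T W N ω)) → H =ᵐ[volume] F := by
    intro H hH hXH
    refine (absolutelyContinuous_gaussianPi hv).ae_le ?_
    rw [← hV.map_eq]
    exact (ae_map_iff hV.aemeasurable (measurableSet_eq_fun hH hFm)).2 (hXH.symm.trans hXF)
  have hpull : ∀ {H : (Fin N → ℝ) → ℝ} {Y : Ω → ℝ}, Measurable H → MemLp Y 2 P →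
      Y =ᵐ[P] (fun ω => H (incrVec T W N ω)) → MemLp H 2 (gaussianPi N v) := by
    intro H Y hH hY hYH
    rw [← hV.map_eq, memLp_map_measure_iff hH.aestronglyMeasurable hV.aemeasurable]
    exact hY.ae_eq hYH
  have hw1 : ∀ l, IsWeakPartialDeriv l 1 F (G₁ l) := fun l =>
    (w₁ l).congr_ae (huniq (mF₁ l) (eF₁ l))
  have hw2 : ∀ l, IsWeakPartialDeriv l 1 (G₁ l) (G₂ l) := fun l =>
    (hw1 l).of_second ((w₂ l).congr_ae (huniq (mF₂ l) (eF₂ l)))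
  have hFL : MemLp F 2 (gaussianPi N v) := hpull hFm hX.1 hXF
  have hG1L : ∀ l, MemLp (G₁ l) 2 (gaussianPi N v) := fun l => hpull (mG₁ l) (hL1 l) (eG₁ l)
  have hG2L : ∀ l, MemLp (G₂ l) 2 (gaussianPi N v) := fun l => hpull (mG₂ l) (hL2 l) (eG₂ l)
  set R : (Fin N → ℝ) → ℝ := fun x =>
    F x - (∫ y, F y ∂(gaussianPi N v) + ∑ l : Fin N, pastAvg v l (G₁ l) x * x l) with hR
  have hRm : Measurable R := hFm.sub (measurable_const.add (Finset.measurable_fun_sum _ fun l _ =>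
    (measurable_pastAvg _ (mG₁ l)).mul (measurable_pi_apply l)))
  have hbound := lintegral_sub_approx_sq_le hv hFm mG₁ mG₂ hFL hG1L hG2L
    (fun l => isLineDeriv_of_isWeakPartialDeriv hv hFm (mG₁ l) (hw1 l))
    (fun l => isLineDeriv_of_isWeakPartialDeriv hv (mG₁ l) (mG₂ l) (hw2 l))
  have hmean : ∫ ω, X ω ∂P = ∫ y, F y ∂(gaussianPi N v) := by
    rw [integral_congr_ae hXF, ← hV.map_eq, integral_map hV.aemeasurable hFm.aestronglyMeasurable]
  have hcond : ∀ l : Fin N, P[functionalDeriv T W P l 1 X | sigmaIncr T W N l]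
      =ᵐ[P] fun ω => pastAvg v l (G₁ l) (incrVec T W N ω) := by
    intro l
    refine (condExp_congr_ae (eG₁ l)).trans ?_
    rw [sigmaIncr_eq]
    exact condExp_comp_eq_partialAvg hV.measurable hV.map_eq _ (mG₁ l)
      ((hG1L l).integrable (by norm_num))
  have herr : (fun ω => X ω - clarkOconeApprox T W P N X ω)
      =ᵐ[P] fun ω => R (incrVec T W N ω) := by
    filter_upwards [hXF, ae_all_iff.2 hcond] with ω h1 h2
    simp only [clarkOconeApprox, hR, h1, hmean]
    congr 2
    exact Finset.sum_congr rfl fun l _ => by rw [h2 l]; rfl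
  refine ⟨(hRm.comp hV.measurable).aestronglyMeasurable.congr herr.symm, ?_⟩
  rw [eLpNorm_congr_ae herr, eLpNorm_two_sq]
  have h2 : ∀ l, eLpNorm (functionalDeriv T W P l 2 X) 2 P ^ 2
      = ∫⁻ x, ‖G₂ l x‖ₑ ^ 2 ∂(gaussianPi N v) := fun l => by
    rw [eLpNorm_congr_ae (eG₂ l), eLpNorm_two_sq]
    exact hV.lintegral_comp (f := fun x => ‖G₂ l x‖ₑ ^ 2) ((mG₂ l).enorm.pow_const 2)
  calc ∫⁻ ω, ‖R (incrVec T W N ω)‖ₑ ^ 2 ∂P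
      = ∫⁻ x, ‖R x‖ₑ ^ 2 ∂(gaussianPi N v) :=
        hV.lintegral_comp (f := fun x => ‖R x‖ₑ ^ 2) (hRm.enorm.pow_const 2)
    _ ≤ 4 * v ^ 2 * ∑ l : Fin N, eLpNorm (functionalDeriv T W P l 2 X) 2 P ^ 2 := by
        simp only [h2]; exact hbound
    _ = 4 * v * (v * ∑ l : Fin N, eLpNorm (functionalDeriv T W P l 2 X) 2 P ^ 2) := by ring
    _ ≤ _ := by
        gcongr
        exact sum_eLpNorm_sq_le_lintegral_malliavinDeriv hT hN 2 X

end BrownianIncrements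

end DiscreteClarkOcone

/-! ### The rate of convergence. -/

theorem corollary3p3 {Ω : Type*} [MeasurableSpace Ω] (P : Measure Ω) [IsProbabilityMeasure P]
    (T : ℝ) (hT : 0 < T) (W : ℝ → Ω → ℝ) (hW : DiscreteClarkOcone.IsBrownianMotionOn T W P)
    (X : ℕ → Ω → ℝ) (hX : ∀ N : ℕ, 1 ≤ N → DiscreteClarkOcone.MemD T W P N 2 (X N))
    (hsup : (⨆ (N : ℕ) (_ : 1 ≤ N), ∫⁻ t in Set.Icc (0 : ℝ) T,
      (eLpNorm (DiscreteClarkOcone.malliavinDeriv T W P N 2 (X N) t) 2 P) ^ 2) < (∞ : ℝ≥0∞)) :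
    (∀ N : ℕ, 1 ≤ N →
      MemLp (fun ω => X N ω - DiscreteClarkOcone.clarkOconeApprox T W P N (X N) ω) 2 P) ∧
    (fun N : ℕ =>
      (eLpNorm (fun ω => X N ω - DiscreteClarkOcone.clarkOconeApprox T W P N (X N) ω) 2 P).toReal)
        =O[atTop] (fun N : ℕ => (N : ℝ) ^ (-(1 / 2) : ℝ)) := by
  set K := ⨆ (N : ℕ) (_ : 1 ≤ N), ∫⁻ t in Set.Icc (0 : ℝ) T,
      (eLpNorm (DiscreteClarkOcone.malliavinDeriv T W P N 2 (X N) t) 2 P) ^ 2 with hK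
  have hle : ∀ N : ℕ, 1 ≤ N →
      eLpNorm (fun ω => X N ω - DiscreteClarkOcone.clarkOconeApprox T W P N (X N) ω) 2 P ^ 2
        ≤ 4 * (T / N).toNNReal * K := fun N hN =>
    (DiscreteClarkOcone.eLpNorm_sub_clarkOconeApprox_sq_le hT hW hN (hX N hN)).2.trans
      (by gcongr; exact le_iSup₂ (f := fun (N : ℕ) (_ : 1 ≤ N) => ∫⁻ t in Set.Icc (0 : ℝ) T,
        (eLpNorm (DiscreteClarkOcone.malliavinDeriv T W P N 2 (X N) t) 2 P) ^ 2) N hN)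
  have hfin : ∀ N : ℕ, 4 * ((T / N).toNNReal : ℝ≥0∞) * K < ∞ := fun N =>
    ENNReal.mul_lt_top (ENNReal.mul_lt_top (by simp) ENNReal.coe_lt_top) hsup
  refine ⟨fun N hN => ⟨
    (DiscreteClarkOcone.eLpNorm_sub_clarkOconeApprox_sq_le hT hW hN (hX N hN)).1, ?_⟩, ?_⟩
  · by_contra h
    have h1 := (hle N hN).trans_lt (hfin N)
    rw [not_lt_top_iff.1 h] at h1
    simp at h1
  -- The constant is read off from the bound $4(T/N)K$ on the squared norm.
  · refine Asymptotics.IsBigO.of_bound (Real.sqrt (4 * T * K.toReal)) ?_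
    filter_upwards [eventually_ge_atTop 1] with N hN
    have hN' : (0 : ℝ) < N := by exact_mod_cast hN
    have h1 := ENNReal.toReal_mono (hfin N).ne (hle N hN)
    rw [ENNReal.toReal_pow, ENNReal.toReal_mul, ENNReal.toReal_mul, ENNReal.coe_toReal,
      Real.coe_toNNReal _ (div_pos hT hN').le, ENNReal.toReal_ofNat] at h1
    rw [Real.norm_of_nonneg ENNReal.toReal_nonneg, Real.norm_of_nonneg (by positivity),
      Real.rpow_neg hN'.le, ← Real.sqrt_eq_rpow, ← Real.sqrt_inv, ← Real.sqrt_mul (by positivity)]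
    refine Real.le_sqrt_of_sq_le (h1.trans (le_of_eq ?_))
    field_simp
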